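/- Let $d>2$ be an integer and $\lambda=d/2-1$. Let $G$ be a finite graph (parallel edges allowed) with at least one edge, whose vertex set is the disjoint union of a set $\mathcal V^{\rm ext}$ of external and a set $\mathcal V^{\rm int}$ of internal vertices, with edge set $\mathcal E$ and edge weights $\nu_e>0$. Let $x=(x_v)_{v\in\mathcal V^{\rm ext}}$ be pairwise distinct vectors in $\mathbb R^d$, put $Q_e=\|x_u-x_v\|^2$ for an edge $e$ with endpoints $u,v$, and assume that the integral $$f_G(x)=\Big(\prod_{v\in\mathcal V^{\rm int}}\int_{\mathbb R^d}\frac{d^dx_v}{\pi^{d/2}}\Big)\frac1{\prod_{e}Q_e^{\lambda\nu_e}}$$ converges. Let $M_G=\lambda\sum_e\nu_e-\tfrac d2|\mathcal V^{\rm int}|$. For a set $p=\{p_1,\dots,p_n\}$ of disjoint sets of vertices let $\mathcal F_G^p$ be the set of spanning forests of $G$ consisting of exactly $n$ disjoint trees $T_1,\dots,T_n$ with $p_i\subseteq T_i$, and let $$\Psi_G^p(\alpha)=\sum_{F\in\mathcal F_G^p}\prod_{e\notin F}\alpha_e,\qquad \tilde\Psi_G^p(\alpha)=\sum_{F\in\mathcal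 F_G^p}\prod_{e\in F}\alpha_e .$$ Let $\Psi_G=\Psi_G^p$ for the partition $p$ of $\mathcal V^{\rm ext}$ into singletons, and let $\Phi_G(\alpha,x)=\sum_{\{i,j\}}\|x_i-x_j\|^2\,\Psi_G^{p_{ij}}(\alpha)$, where the sum is over unordered pairs of distinct external vertices and $p_{ij}$ is the partition of $\mathcal V^{\rm ext}$ into $\{i,j\}$ and the singletons $\{k\}$, $k\ne i,j$. Then $M_G>0$, the function $$g(\alpha)=\frac{\prod_e\alpha_e^{d/2-\lambda\nu_e-1}}{\Phi_G(\alpha,x)^{M_G}\,\Psi_G(\alpha)^{d/2-M_G}}$$ on $\{\alpha:\alpha_e>0\ \forall e\}$ is homogeneous of degree $-|\mathcal E|$, and $$f_G(x)=\frac{\Gamma(M_G)}{\prod_e\Gamma(\lambda\nu_e)}\int_\Delta g\,\Omega,$$ where $\int_\Delta g\,\Omega$ is the absolutely convergent projective integral over the positive coordinate simplex $\Delta=\{(\alpha_e)_{e\in\mathcal E}:\alpha_e>0\ \forall e\}\subset\mathbb P^{|\mathcal E|-1}\mathbb R$, that is, for any choice of an edge $e_0$, the integral of $g|_{\alpha_{e_0}=1}$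 with respect to $\prod_{e\neq e_0}d\alpha_e$ over $(0,\infty)^{\mathcal E\setminus\{e_0\}}$. Moreover, for every $p$ and all $\alpha$ with $\alpha_e\neq0$ for all $e$, $\Psi_G^p(\alpha)=\big(\prod_e\alpha_e\big)\tilde\Psi_G^p(1/\alpha)$, where $1/\alpha=(1/\alpha_e)_e$. -/

import Mathlib

open scoped ENNReal

noncomputable section

/-- A Feynman graph with set of external vertices `X`, set of internal vertices `I` (so its vertex
set is `X ⊕ I`), set of edges `E` and real edge weights. Several edges may have the same
endpoints; loops are not forbidden (an edge of positive weight that is a loop makes the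
Feynman integral diverge). -/
structure FeynmanGraph (X I E : Type*) where
  ends : E → Sym2 (X ⊕ I)
  weight : E → ℝ

namespace FeynmanGraph

/-- The squared Euclidean distance of the two points attached to an unordered pair of labels. -/
def sqDist {A : Type*} {d : ℕ} (x : A → EuclideanSpace ℝ (Fin d)) : Sym2 A → ℝ :=
  Sym2.lift ⟨fun u v => ‖x u - x v‖ ^ 2, fun u v => by simp only [norm_sub_rev]⟩

/-- `λ`, where `d = 2 λ + 2` is the dimension. -/
def lam (d : ℕ) : ℝ := (d : ℝ) / 2 - 1

variable {X I E : Type*} (G : FeynmanGraph X I E)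

/-! ### The Feynman integral in position space -/

/-- The integrand `1 / ∏ₑ Qₑ ^ (λ νₑ)` for external vectors `x` and internal vectors `w`, with
values in `[0, ∞]`. -/
def positionIntegrand [Fintype E] (d : ℕ) (x : X → EuclideanSpace ℝ (Fin d))
    (w : I → EuclideanSpace ℝ (Fin d)) : ℝ≥0∞ :=
  (∏ e, ENNReal.ofReal (sqDist (Sum.elim x w) (G.ends e)) ^ (lam d * G.weight e))⁻¹

/-- The value in `[0, ∞]` of `(∏ᵥ ∫ dᵈxᵥ / π ^ (d / 2)) 1 / ∏ₑ Qₑ ^ (λ νₑ)`, the product being over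
the internal vertices `v`. -/
def positionIntegral [Fintype I] [Fintype E] (d : ℕ) (x : X → EuclideanSpace ℝ (Fin d)) : ℝ≥0∞ :=
  ENNReal.ofReal ((1 / Real.pi ^ ((d : ℝ) / 2)) ^ Fintype.card I) *
    ∫⁻ w : I → EuclideanSpace ℝ (Fin d), G.positionIntegrand d x w

/-- Convergence of the Feynman integral (of a nonnegative function) at `x`. -/
def Converges [Fintype I] [Fintype E] (d : ℕ) (x : X → EuclideanSpace ℝ (Fin d)) : Prop :=
  G.positionIntegral d x < ∞

/-- The Feynman integral `f_G(x)` as a real number (meaningful when it converges). -/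
def feynmanIntegral [Fintype I] [Fintype E] (d : ℕ) (x : X → EuclideanSpace ℝ (Fin d)) : ℝ :=
  (G.positionIntegral d x).toReal

/-- The superficial degree of divergence `M_G = λ ν_G - (d / 2) V_int`. -/
def superficialDegree [Fintype I] [Fintype E] (d : ℕ) : ℝ :=
  lam d * ∑ e, G.weight e - (d : ℝ) / 2 * Fintype.card I

/-! ### Spanning forest polynomials -/

/-- The simple graph on the vertices of `G` in which two distinct vertices are adjacent if they are
joined by an edge in `F`. -/
def edgeGraph (F : Finset E) : SimpleGraph (X ⊕ I) :=
  SimpleGraph.fromEdgeSet (G.ends '' (F : Set E))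

/-- The spanning subgraph of `G` with edge set `F` has no cycles: it has no loops, no two parallel
edges, and no cycles of length at least three. -/
def IsForest (F : Finset E) : Prop :=
  (∀ e ∈ F, ¬ (G.ends e).IsDiag) ∧ Set.InjOn G.ends (F : Set E) ∧ (G.edgeGraph F).IsAcyclic

/-- `F` is the edge set of a spanning forest whose trees `T_P` are indexed by the parts `P` of `p`
such that `P ⊆ T_P`. -/
def IsSpanningForest (p : Set (Set (X ⊕ I))) (F : Finset E) : Prop :=
  G.IsForest F ∧ ∃ T : p ≃ (G.edgeGraph F).ConnectedComponent, ∀ P : p, (P : Set _) ⊆ (T P).supp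

open scoped Classical in
/-- The set of all spanning forests for `p`, given by their edge sets. -/
def spanningForests [Fintype E] (p : Set (Set (X ⊕ I))) : Finset (Finset E) :=
  Finset.univ.filter (G.IsSpanningForest p)

/-- The spanning forest polynomial `Ψ^p(α) = ∑_F ∏_{e ∉ F} αₑ`. -/
def forestPoly [Fintype E] [DecidableEq E] (p : Set (Set (X ⊕ I))) (α : E → ℝ) : ℝ :=
  ∑ F ∈ G.spanningForests p, ∏ e ∈ Fᶜ, α e

/-- The dual spanning forest polynomial `∑_F ∏_{e ∈ F} αₑ`. -/
def dualForestPoly [Fintype E] (p : Set (Set (X ⊕ I))) (α : E → ℝ) : ℝ :=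
  ∑ F ∈ G.spanningForests p, ∏ e ∈ F, α e

/-- The partition of the external vertices into singletons. -/
def singletonPartition (X I : Type*) : Set (Set (X ⊕ I)) :=
  {P | ∃ k : X, P = {Sum.inl k}}

/-- For `z = {i, j}`, the partition of the external vertices into `{i, j}` and the singletons `{k}`
with `k ≠ i, j`. -/
def pairPartition (I : Type*) {X : Type*} (z : Sym2 X) : Set (Set (X ⊕ I)) :=
  {P | P = Sum.inl '' {k | k ∈ z} ∨ ∃ k : X, k ∉ z ∧ P = {Sum.inl k}}

/-- `Ψ_G`, the spanning forest polynomial of the partition into singletons. -/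
def psi [Fintype E] [DecidableEq E] (α : E → ℝ) : ℝ :=
  G.forestPoly (singletonPartition X I) α

/-- `Φ_G(α, x) = ∑_{i < j} ‖xᵢ - xⱼ‖² Ψ_G^{ij, (k)_{k ≠ i, j}}(α)`, the sum being over all unordered
pairs `{i, j}` of distinct external vertices. -/
def phi [Fintype X] [DecidableEq X] [Fintype E] [DecidableEq E] {d : ℕ}
    (x : X → EuclideanSpace ℝ (Fin d)) (α : E → ℝ) : ℝ :=
  ∑ z : Sym2 X with ¬ z.IsDiag, sqDist x z * G.forestPoly (pairPartition I z) α

/-! ### The parametric integral -/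

/-- The integrand `∏ₑ αₑ ^ (d/2 - λ νₑ - 1) / (Φ_G ^ M_G * Ψ_G ^ (d/2 - M_G))`. -/
def parametricIntegrand [Fintype X] [DecidableEq X] [Fintype I] [Fintype E] [DecidableEq E] {d : ℕ}
    (x : X → EuclideanSpace ℝ (Fin d)) (α : E → ℝ) : ℝ :=
  (∏ e, α e ^ ((d : ℝ) / 2 - lam d * G.weight e - 1)) /
    (G.phi x α ^ G.superficialDegree d * G.psi α ^ ((d : ℝ) / 2 - G.superficialDegree d))

end FeynmanGraph

/-! ### Projective integrals over the positive simplex -/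

/-- The point with homogeneous coordinates `βₑ` for `e ≠ e₀` and coordinate `1` at `e₀`. -/
def affineChart {E : Type*} [DecidableEq E] (e₀ : E) (β : {e : E // e ≠ e₀} → ℝ) : E → ℝ :=
  fun e => if h : e = e₀ then 1 else β ⟨e, h⟩

/-- A function `g` on the open positive orthant is homogeneous of degree `-|E|`; this says that
`g Ω` descends to the positive coordinate simplex `Δ` in projective space. -/
def IsProjectiveDensity {E : Type*} [Fintype E] (g : (E → ℝ) → ℝ) : Prop :=
  ∀ (t : ℝ) (α : E → ℝ), 0 < t → (∀ e, 0 < α e) →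
    g (fun e => t * α e) = (t ^ Fintype.card E)⁻¹ * g α

/-- Absolute convergence of `∫_Δ g Ω`, in the affine chart `α_{e₀} = 1`, where `Δ` is the open
positive orthant and `Ω` is Lebesgue measure in the remaining coordinates. -/
def ProjectiveIntegrable {E : Type*} [Fintype E] [DecidableEq E] (e₀ : E)
    (g : (E → ℝ) → ℝ) : Prop :=
  MeasureTheory.IntegrableOn (fun β : {e : E // e ≠ e₀} → ℝ => g (affineChart e₀ β))
    {β | ∀ e, 0 < β e}

/-- The projective integral `∫_Δ g Ω`, computed in the affine chart `α_{e₀} = 1`. -/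
def projectiveIntegral {E : Type*} [Fintype E] [DecidableEq E] (e₀ : E) (g : (E → ℝ) → ℝ) : ℝ :=
  ∫ β in {β : {e : E // e ≠ e₀} → ℝ | ∀ e, 0 < β e}, g (affineChart e₀ β)

end

/-! Each propagator is written by the Schwinger trick in the inverse variable, `Γ(s) Q ^ (-s) = ∫ a
^ (-s - 1) exp (-Q / a) da`. For fixed parameters `α` the integrand is then a Gaussian in the
internal vectors, and its exponent is minus the energy of an electrical network with conductances `1
/ α e`. The `d` coordinates decouple.

In each coordinate one completes the square in the weighted Laplacian. By the matrix-tree theorem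
the determinant of the internal block is the dual polynomial of the singleton partition
(`det_laplacian_internal`). The minimal energy is the quadratic form of the Schur complement on the
external vertices. Its off-diagonal entries are ratios of minors, evaluated by an all-minors
matrix-tree theorem (`det_laplacian_withExternal`). Both come from Cauchy–Binet and incidence minors
equal to `0` or `±1`. Passing from `1 / α` to `α` leaves the integrand `∏ α e ^ (d/2 - λ ν e - 1) *
Ψ ^ (-d/2) * exp (-Φ / Ψ)` (`schwinger_representation`).

As `Φ / Ψ` is homogeneous of degree `-1`, integrating along rays gives `Γ(M) (Ψ / Φ) ^ M` and leaves
the projective integral (`projective_representation`).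

Until the end all integrals take values in `[0, ∞]`, so Tonelli applies freely. Convergence serves
to exclude the cases where a Gaussian or ray integral is infinite, which gives `Ψ > 0`, `M > 0`, and
`Φ > 0` almost everywhere. -/

namespace SimpleGraph

/-! ### Counting components when an edge is added. -/

variable {V : Type*} {H : SimpleGraph V} {u v : V}

/-- The components of a graph with one more edge are those of the graph, up to one merging. -/
theorem Reachable.of_sup_edge {a b : V} (h : (H ⊔ edge u v).Reachable a b) :
    H.Reachable a b ∨ (H.Reachable a u ∧ H.Reachable v b) ∨
      (H.Reachable a v ∧ H.Reachable u b) := by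
  rw [reachable_iff_reflTransGen] at h
  induction h with
  | refl => exact Or.inl (Reachable.refl _)
  | @tail b c _ hbc ih =>
    rw [sup_adj, edge_adj] at hbc
    rcases hbc with hbc | ⟨⟨rfl, rfl⟩ | ⟨rfl, rfl⟩, -⟩
    · have := hbc.reachable
      rcases ih with ih | ⟨h1, h2⟩ | ⟨h1, h2⟩
      · exact Or.inl (ih.trans this)
      · exact Or.inr (Or.inl ⟨h1, h2.trans this⟩)
      · exact Or.inr (Or.inr ⟨h1, h2.trans this⟩)
    · rcases ih with ih | ⟨h1, h2⟩ | ⟨h1, h2⟩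
      · exact Or.inr (Or.inl ⟨ih, Reachable.refl _⟩)
      · exact Or.inr (Or.inl ⟨h1, Reachable.refl _⟩)
      · exact Or.inl h1
    · rcases ih with ih | ⟨h1, h2⟩ | ⟨h1, h2⟩
      · exact Or.inr (Or.inr ⟨ih, Reachable.refl _⟩)
      · exact Or.inl h1
      · exact Or.inr (Or.inr ⟨h1, Reachable.refl _⟩)

theorem card_connectedComponent_sup_edge_of_reachable (h : H.Reachable u v) :
    Nat.card (H ⊔ edge u v).ConnectedComponent = Nat.card H.ConnectedComponent := by
  refine (Nat.card_congr (Equiv.ofBijective _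
    ⟨?_, ConnectedComponent.surjective_map_ofLE (le_sup_left : H ≤ H ⊔ edge u v)⟩)).symm
  intro a b
  refine ConnectedComponent.ind₂ (fun a b hab => ?_) a b
  simp only [ConnectedComponent.map_mk, ConnectedComponent.eq] at hab
  rw [ConnectedComponent.eq]
  rcases hab.of_sup_edge with h' | ⟨h1, h2⟩ | ⟨h1, h2⟩
  · exact h'
  · exact h1.trans (h.trans h2)
  · exact h1.trans (h.symm.trans h2)

theorem card_connectedComponent_sup_edge_of_not_reachable [Finite V] (h : ¬ H.Reachable u v) :
    Nat.card (H ⊔ edge u v).ConnectedComponent + 1 = Nat.card H.ConnectedComponent := by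
  classical
  have huv : u ≠ v := fun e => h (e ▸ Reachable.refl _)
  let c := H.connectedComponentMk v
  have hle : H ≤ H ⊔ edge u v := le_sup_left
  -- Discarding the component of `v` gives a bijection, the component of `u` standing for the merged
  -- one.
  have key : Nat.card {a : H.ConnectedComponent // a ≠ c} =
      Nat.card (H ⊔ edge u v).ConnectedComponent := by
    refine Nat.card_congr (Equiv.ofBijective
      (fun a => a.1.map (Hom.ofLE hle)) ⟨?_, ?_⟩)
    · rintro ⟨a, ha⟩ ⟨b, hb⟩
      revert ha hb
      refine ConnectedComponent.ind₂ (fun a b ha hb hab => ?_) a b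
      simp only [ConnectedComponent.map_mk, ConnectedComponent.eq] at hab
      simp only [c, ne_eq, ConnectedComponent.eq] at ha hb
      rw [Subtype.mk.injEq, ConnectedComponent.eq]
      rcases hab.of_sup_edge with h' | ⟨h1, h2⟩ | ⟨h1, h2⟩
      · exact h'
      · exact absurd h2.symm hb
      · exact absurd h1 ha
    · refine ConnectedComponent.ind fun a => ?_
      by_cases ha : H.Reachable a v
      · refine ⟨⟨H.connectedComponentMk u, ?_⟩, ?_⟩
        · simpa [c, ConnectedComponent.eq] using h
        · simp only [ConnectedComponent.map_mk, ConnectedComponent.eq]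
          have h1 : (H ⊔ edge u v).Adj u v := by simp [edge_adj, huv]
          exact h1.reachable.trans (ha.symm.mono hle)
      · exact ⟨⟨H.connectedComponentMk a, by simpa [c, ConnectedComponent.eq] using ha⟩, rfl⟩
  rw [← key, ← Finite.card_option]
  exact Nat.card_congr (Equiv.optionSubtypeNe c)

end SimpleGraph

/-! ### Spanning forests characterised by edge count and reachability. -/

namespace FeynmanGraph

open SimpleGraph

variable {X I E : Type*} (G : FeynmanGraph X I E)

theorem edgeGraph_adj {F : Finset E} {a b : X ⊕ I} :
    (G.edgeGraph F).Adj a b ↔ (∃ e ∈ F, G.ends e = s(a, b)) ∧ a ≠ b := by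
  simp [edgeGraph, fromEdgeSet_adj]

theorem edgeGraph_insert [DecidableEq E] (F : Finset E) (e : E) {u v : X ⊕ I}
    (he : G.ends e = s(u, v)) :
    G.edgeGraph (insert e F) = G.edgeGraph F ⊔ edge u v := by
  ext a b
  rw [sup_adj, edgeGraph_adj, edgeGraph_adj, edge_adj]
  simp only [Finset.exists_mem_insert, he, Sym2.eq_iff]
  grind

/-- Unreachability of the endpoints excludes at once a loop, a parallel edge and a new cycle. -/
theorem isForest_insert [DecidableEq E] {F : Finset E} {e : E} (heF : e ∉ F) {u v : X ⊕ I}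
    (he : G.ends e = s(u, v)) :
    G.IsForest (insert e F) ↔ G.IsForest F ∧ ¬ (G.edgeGraph F).Reachable u v := by
  simp only [IsForest, G.edgeGraph_insert F e he, isAcyclic_sup_fromEdgeSet_iff,
    Finset.forall_mem_insert, he, Sym2.mk_isDiag_iff, Finset.coe_insert,
    Set.injOn_insert (show e ∉ (F : Set E) by simpa using heF), edgeGraph_adj, Set.mem_image,
    Finset.mem_coe]
  constructor
  · rintro ⟨⟨h1, h2⟩, ⟨h3, h4⟩, h5, h6⟩
    exact ⟨⟨h2, h3, h5⟩, fun h => (h6 h).elim h1 fun h => h4 h.1⟩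
  · rintro ⟨⟨h2, h3, h5⟩, h6⟩
    have huv : u ≠ v := fun e => h6 (e ▸ Reachable.refl _)
    refine ⟨⟨huv, h2⟩, ⟨h3, fun h => h6 ?_⟩, h5, fun h => absurd h h6⟩
    exact Adj.reachable (G.edgeGraph_adj.2 ⟨h, huv⟩)

/-- A spanning subgraph has at least `|V| - |F|` components, and it is a forest if it has exactly
that many. -/
theorem card_add_card_connectedComponent [Finite X] [Finite I] [DecidableEq E] (F : Finset E) :
    Nat.card (X ⊕ I) ≤ F.card + Nat.card (G.edgeGraph F).ConnectedComponent ∧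
    (G.IsForest F ↔
      Nat.card (X ⊕ I) = F.card + Nat.card (G.edgeGraph F).ConnectedComponent) := by
  induction F using Finset.induction_on with
  | empty =>
    have h0 : G.edgeGraph ∅ = ⊥ := by simp [edgeGraph]
    have hc : Nat.card (G.edgeGraph ∅).ConnectedComponent = Nat.card (X ⊕ I) := by
      rw [h0]
      refine (Nat.card_congr (Equiv.ofBijective
        (connectedComponentMk (⊥ : SimpleGraph (X ⊕ I))) ⟨?_, Quot.mk_surjective⟩)).symm
      intro a b hab
      simpa [ConnectedComponent.eq, reachable_bot] using hab
    rw [hc]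
    simp [IsForest, h0]
  | insert e F heF ih =>
    induction hz : G.ends e with
    | _ u v =>
    rw [G.isForest_insert heF hz, G.edgeGraph_insert F e hz, Finset.card_insert_of_notMem heF]
    -- An edge inside a component destroys the forest and keeps the component count; an edge between
    -- components does the opposite.
    by_cases h : (G.edgeGraph F).Reachable u v
    · rw [card_connectedComponent_sup_edge_of_reachable h]
      simp only [h, not_true, and_false, false_iff]
      omega
    · have := card_connectedComponent_sup_edge_of_not_reachable h
      simp only [h, not_false_iff, and_true, ih.2]
      omega

/-- The component of a representative of each part. -/
theorem isSpanningForest_range_iff {Y : Type*} (q : Y → Set (X ⊕ I)) (hq : Function.Injective q)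
    (F : Finset E) :
    G.IsSpanningForest (Set.range q) F ↔
      G.IsForest F ∧ ∃ T : Y ≃ (G.edgeGraph F).ConnectedComponent, ∀ y, q y ⊆ (T y).supp := by
  refine and_congr_right fun _ => ⟨?_, ?_⟩
  · rintro ⟨T, hT⟩
    exact ⟨(Equiv.ofInjective q hq).trans T, fun y => hT ⟨q y, y, rfl⟩⟩
  · rintro ⟨T, hT⟩
    refine ⟨(Equiv.ofInjective q hq).symm.trans T, ?_⟩
    rintro ⟨_, y, rfl⟩
    simpa using hT y

/-- The edge count forces at least `|Y|` components and surjectivity allows at most `|Y|`, so both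
acyclicity and injectivity follow. Edge count and spanning are what incidence minors can detect. -/
theorem isForest_and_bijective_iff [Fintype X] [Fintype I] [DecidableEq E] {Y : Type*} [Fintype Y]
    (r : Y → X ⊕ I) (F : Finset E) :
    (G.IsForest F ∧ Function.Bijective fun y => (G.edgeGraph F).connectedComponentMk (r y)) ↔
      F.card + Fintype.card Y = Fintype.card X + Fintype.card I ∧
        ∀ v, ∃ y, (G.edgeGraph F).Reachable (r y) v := by
  obtain ⟨h1, h2⟩ := G.card_add_card_connectedComponent F
  have hV : Nat.card (X ⊕ I) = Fintype.card X + Fintype.card I := by simp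
  have hsurj : (Function.Surjective fun y => (G.edgeGraph F).connectedComponentMk (r y)) ↔
      ∀ v, ∃ y, (G.edgeGraph F).Reachable (r y) v := by
    constructor
    · intro h v
      obtain ⟨y, hy⟩ := h (connectedComponentMk _ v)
      exact ⟨y, ConnectedComponent.exact hy⟩
    · intro h
      refine ConnectedComponent.ind fun v => ?_
      obtain ⟨y, hy⟩ := h v
      exact ⟨y, ConnectedComponent.sound hy⟩
  have := Fintype.ofFinite (G.edgeGraph F).ConnectedComponent
  rw [Nat.card_eq_fintype_card (α := (G.edgeGraph F).ConnectedComponent)] at h1 h2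
  rw [← hsurj, h2]
  constructor
  · rintro ⟨h3, h4⟩
    exact ⟨by rw [Fintype.card_of_bijective h4]; omega, h4.2⟩
  · rintro ⟨h3, h4⟩
    have := Fintype.card_le_of_surjective _ h4
    refine ⟨by omega, (Fintype.bijective_iff_surjective_and_card _).2 ⟨h4, by omega⟩⟩

theorem isSpanningForest_singletonPartition_iff [Fintype X] [Fintype I] [DecidableEq E]
    (F : Finset E) :
    G.IsSpanningForest (singletonPartition X I) F ↔
      F.card = Fintype.card I ∧ ∀ v, ∃ k : X, (G.edgeGraph F).Reachable (Sum.inl k) v := by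
  have hp : singletonPartition X I = Set.range fun k : X => ({Sum.inl k} : Set (X ⊕ I)) := by
    ext P; simp [singletonPartition, eq_comm]
  have hinj : Function.Injective fun k : X => ({Sum.inl k} : Set (X ⊕ I)) := fun a b h => by
    simpa using h
  rw [hp, G.isSpanningForest_range_iff _ hinj]
  have := G.isForest_and_bijective_iff (fun k : X => (Sum.inl k : X ⊕ I)) F
  rw [show F.card = Fintype.card I ↔ F.card + Fintype.card X = Fintype.card X + Fintype.card I by
    omega, ← this]
  refine and_congr_right fun _ => ⟨?_, fun h => ⟨Equiv.ofBijective _ h, ?_⟩⟩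
  · rintro ⟨T, hT⟩
    have : (fun k : X => (G.edgeGraph F).connectedComponentMk (Sum.inl k)) = T :=
      funext fun k => by simpa using hT k
    rw [this]
    exact T.bijective
  · simp

/-- Each of the two reachability conditions governs the nonvanishing of one of the two incidence
minors in the all-minors theorem. -/
theorem isSpanningForest_pairPartition_iff [Fintype X] [DecidableEq X] [Fintype I] [DecidableEq E]
    {i j : X} (hij : i ≠ j) (F : Finset E) :
    G.IsSpanningForest (pairPartition I s(i, j)) F ↔
      F.card = Fintype.card I + 1 ∧
        (∀ v, ∃ k : X, k ≠ i ∧ (G.edgeGraph F).Reachable (Sum.inl k) v) ∧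
        (∀ v, ∃ k : X, k ≠ j ∧ (G.edgeGraph F).Reachable (Sum.inl k) v) := by
  -- The parts are indexed by the external vertices other than `i`; the index `j` stands for the
  -- part `{i, j}`.
  let Y := {k : X // k ≠ i}
  let q : Y → Set (X ⊕ I) := fun k => if k.1 = j then {Sum.inl i, Sum.inl j} else {Sum.inl k.1}
  have hmem : ∀ k : Y, Sum.inl k.1 ∈ q k := fun k => by
    by_cases h : k.1 = j <;> simp [q, h]
  have hp : pairPartition I s(i, j) = Set.range q := by
    ext P
    simp only [pairPartition, Set.mem_ofPred_eq, Set.mem_range, Sym2.mem_iff, q]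
    constructor
    · rintro (rfl | ⟨k, hk, rfl⟩)
      · refine ⟨⟨j, hij.symm⟩, ?_⟩
        simp only [if_true]
        ext v; simp; grind
      · push Not at hk
        exact ⟨⟨k, hk.1⟩, by simp [hk.2]⟩
    · rintro ⟨⟨k, hk⟩, rfl⟩
      by_cases h : k = j
      · left
        ext v; simp [h]; grind
      · exact Or.inr ⟨k, by tauto, by simp [h]⟩
  have hinj : Function.Injective q := by
    rintro ⟨a, ha⟩ ⟨b, hb⟩ h
    have h1 : Sum.inl a ∈ q ⟨b, hb⟩ := h ▸ hmem ⟨a, ha⟩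
    have h2 : Sum.inl b ∈ q ⟨a, ha⟩ := h ▸ hmem ⟨b, hb⟩
    by_cases ha' : a = j <;> by_cases hb' : b = j <;> simp_all [q]
  have hY : Fintype.card Y + 1 = Fintype.card X := by
    rw [← Fintype.card_option]
    exact Fintype.card_congr (Equiv.optionSubtypeNe i)
  have key := G.isForest_and_bijective_iff (fun k : Y => (Sum.inl k.1 : X ⊕ I)) F
  rw [show F.card + Fintype.card Y = Fintype.card X + Fintype.card I ↔
    F.card = Fintype.card I + 1 by omega] at key
  have hL : (∀ v, ∃ y : Y, (G.edgeGraph F).Reachable (Sum.inl y.1) v) ↔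
      ∀ v, ∃ k : X, k ≠ i ∧ (G.edgeGraph F).Reachable (Sum.inl k) v := by
    simp [Y]
  rw [hL] at key
  rw [hp, G.isSpanningForest_range_iff _ hinj, ← and_assoc, ← key, and_assoc]
  refine and_congr_right fun hF => ⟨?_, ?_⟩
  · rintro ⟨T, hT⟩
    have hTk : (fun k : Y => (G.edgeGraph F).connectedComponentMk (Sum.inl k.1)) = T :=
      funext fun k => by simpa using hT k (hmem k)
    refine ⟨hTk ▸ T.bijective, fun v => ?_⟩
    obtain ⟨y, hy⟩ := T.surjective ((G.edgeGraph F).connectedComponentMk v)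
    have hyv : (G.edgeGraph F).Reachable (Sum.inl y.1) v := by
      rw [← hTk] at hy
      exact ConnectedComponent.exact hy
    by_cases h : y.1 = j
    · have : Sum.inl i ∈ (T y).supp := hT y (by simp [q, h])
      rw [hy] at this
      exact ⟨i, hij, ConnectedComponent.exact this⟩
    · exact ⟨y.1, h, hyv⟩
  · rintro ⟨hb, hj⟩
    refine ⟨Equiv.ofBijective _ hb, fun y => ?_⟩
    by_cases h : y.1 = j
    · obtain ⟨k, hk, hkj⟩ := hj (Sum.inl j)
      -- External vertices other than `i` lie in distinct components, so only `i` can share the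
      -- component of `j`.
      have hki : k = i := by
        by_contra hki
        refine hk (congrArg Subtype.val (hb.1 (a₁ := ⟨k, hki⟩) (a₂ := ⟨j, hij.symm⟩) ?_))
        exact ConnectedComponent.sound hkj
      subst hki
      have := ConnectedComponent.sound hkj
      simp [q, h, Set.insert_subset_iff, this]
    · simp [q, h]

/-- Identifies the external rows that enter the sum of incidence rows over the tree containing `i`.
-/
theorem reachable_iff_of_isSpanningForest_pairPartition [Fintype X] [DecidableEq X] [Fintype I]
    [DecidableEq E] {i j : X} (hij : i ≠ j) {F : Finset E}
    (hF : G.IsSpanningForest (pairPartition I s(i, j)) F) (k : X) :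
    (G.edgeGraph F).Reachable (Sum.inl i) (Sum.inl k) ↔ k = i ∨ k = j := by
  obtain ⟨hc, hi, hj⟩ := (G.isSpanningForest_pairPartition_iff hij F).1 hF
  have hY : Fintype.card {k : X // k ≠ i} + 1 = Fintype.card X := by
    rw [← Fintype.card_option]
    exact Fintype.card_congr (Equiv.optionSubtypeNe i)
  obtain ⟨-, hb, -⟩ := (G.isForest_and_bijective_iff
    (fun k : {k : X // k ≠ i} => (Sum.inl k.1 : X ⊕ I)) F).2 ⟨by omega, by simpa using hi⟩
  have huniq : ∀ k l : X, k ≠ i → l ≠ i →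
      (G.edgeGraph F).Reachable (Sum.inl k) (Sum.inl l) → k = l := fun k l hk hl h =>
    congrArg Subtype.val (hb (a₁ := ⟨k, hk⟩) (a₂ := ⟨l, hl⟩) (ConnectedComponent.sound h))
  have hreach : (G.edgeGraph F).Reachable (Sum.inl i) (Sum.inl j) := by
    obtain ⟨l, hl, hlj⟩ := hj (Sum.inl j)
    by_cases hli : l = i
    · exact hli ▸ hlj
    · exact absurd (huniq l j hli hij.symm hlj) hl
  constructor
  · intro h
    by_cases hk : k = i
    · exact Or.inl hk
    · exact Or.inr (huniq k j hk hij.symm (h.symm.trans hreach))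
  · rintro (rfl | rfl)
    · exact Reachable.refl _
    · exact hreach

end FeynmanGraph

/-! ### The Cauchy–Binet formula. -/

namespace Matrix

variable {D E R : Type*} [Fintype D] [DecidableEq D] [Fintype E] [DecidableEq E] [CommRing R]

/-- The Cauchy–Binet formula, as a sum over functions instead of subsets. -/
theorem factorial_mul_det_mul_diagonal_mul_transpose (A B : Matrix D E R) (c : E → R) :
    ((Fintype.card D).factorial : R) * (A * diagonal c * Bᵀ).det =
      ∑ f : D → E, (∏ i, c (f i)) * ((A.submatrix id f).det * (B.submatrix id f).det) := by
  have h1 : (A * diagonal c * Bᵀ).det =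
      ∑ f : D → E, (∏ i, c (f i)) * ((A.submatrix id f).det * ∏ i, B i (f i)) := by
    have hentry : ∀ a b, (A * diagonal c * Bᵀ) a b = ∑ e, A a e * c e * B b e := fun a b => by
      rw [mul_apply]
      simp [mul_diagonal]
    simp only [det_apply', hentry, Finset.prod_univ_sum,
      Fintype.piFinset_univ, Finset.mul_sum, Finset.sum_mul, submatrix_apply, id_eq]
    rw [Finset.sum_comm]
    refine Finset.sum_congr rfl fun f _ => Finset.sum_congr rfl fun σ _ => ?_
    simp only [Finset.prod_mul_distrib]
    ring
  -- Reindexing `f` by `τ` multiplies the minor of `A` by the sign of `τ`; summing over `τ` then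
  -- turns the product over `B` into a minor, which accounts for the factorial.
  have h2 : ∀ τ : Equiv.Perm D, (A * diagonal c * Bᵀ).det =
      ∑ f : D → E, (∏ i, c (f i)) * ((A.submatrix id f).det *
        (((Equiv.Perm.sign τ : ℤ) : R) * ∏ i, B i (f (τ i)))) := by
    intro τ
    rw [h1, ← (Equiv.arrowCongr τ.symm (Equiv.refl E)).sum_comp]
    refine Finset.sum_congr rfl fun f _ => ?_
    have e1 : (Equiv.arrowCongr τ.symm (Equiv.refl E)) f = f ∘ τ := by
      ext; simp [Equiv.arrowCongr]
    have e2 : A.submatrix id (f ∘ τ) = (A.submatrix id f).submatrix id τ := rfl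
    rw [e1, e2, det_permute']
    simp only [Function.comp_apply]
    rw [Equiv.prod_comp τ (fun i => c (f i))]
    ring
  have h3 : ((Fintype.card D).factorial : R) * (A * diagonal c * Bᵀ).det =
      ∑ τ : Equiv.Perm D, (A * diagonal c * Bᵀ).det := by
    simp [Fintype.card_perm]
  rw [h3, Finset.sum_congr rfl fun τ _ => h2 τ, Finset.sum_comm]
  refine Finset.sum_congr rfl fun f _ => ?_
  rw [← Finset.mul_sum, ← Finset.mul_sum, ← det_transpose (B.submatrix id f),
    det_apply' (B.submatrix id f)ᵀ]
  simp only [transpose_apply, submatrix_apply, id_eq]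

theorem card_functions_with_image (F : Finset E) (hF : F.card = Fintype.card D) :
    (Finset.univ.filter fun f : D → E => Finset.univ.image f = F).card =
      (Fintype.card D).factorial := by
  have e0 : Fintype.card D = Fintype.card F := by simp [hF]
  rw [← Fintype.card_equiv (Fintype.equivOfCardEq e0), ← Finset.card_univ]
  symm
  refine Finset.card_bij (fun g _ i => (g i : E)) ?_ ?_ ?_
  · intro g _
    simp only [Finset.mem_filter, Finset.mem_univ, true_and]
    ext e
    simp only [Finset.mem_image, Finset.mem_univ, true_and]
    constructor
    · rintro ⟨i, rfl⟩; exact (g i).2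
    · intro he; exact ⟨g.symm ⟨e, he⟩, by simp⟩
  · intro g _ g' _ h
    ext i
    exact congrFun h i
  · intro f hf
    simp only [Finset.mem_filter, Finset.mem_univ, true_and] at hf
    have hmem : ∀ i, f i ∈ F := fun i => hf ▸ Finset.mem_image_of_mem f (Finset.mem_univ i)
    have hs : Function.Surjective fun i => (⟨f i, hmem i⟩ : F) := by
      rintro ⟨e, he⟩
      rw [← hf] at he
      obtain ⟨i, -, hi⟩ := Finset.mem_image.1 he
      exact ⟨i, Subtype.ext hi⟩
    exact ⟨Equiv.ofBijective _ ((Fintype.bijective_iff_surjective_and_card _).2 ⟨hs, e0⟩),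
      Finset.mem_univ _, rfl⟩

omit [DecidableEq D] [Fintype E] in
theorem injective_of_card_image {f : D → E}
    (h : (Finset.univ.image f).card = Fintype.card D) : Function.Injective f := by
  rw [← Finset.card_univ] at h
  exact Set.injOn_univ.1 (by simpa using Finset.card_image_iff.1 h)

/-- A weighted sum over sets of columns as a determinant. -/
theorem det_mul_diagonal_mul_transpose_eq_sum [IsDomain R] [CharZero R] (A B : Matrix D E R)
    (c : E → R) (ε : R) (𝓕 : Finset (Finset E)) (hcard : ∀ F ∈ 𝓕, F.card = Fintype.card D)
    (h𝓕 : ∀ f : D → E, (A.submatrix id f).det * (B.submatrix id f).det =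
      if Finset.univ.image f ∈ 𝓕 then ε else 0) :
    (A * diagonal c * Bᵀ).det = ε * ∑ F ∈ 𝓕, ∏ e ∈ F, c e := by
  have h0 : ((Fintype.card D).factorial : R) ≠ 0 := by exact_mod_cast Nat.factorial_ne_zero _
  apply mul_left_cancel₀ h0
  rw [factorial_mul_det_mul_diagonal_mul_transpose]
  simp only [h𝓕, mul_ite, mul_zero, ← Finset.sum_filter]
  -- Each set in `𝓕` is the image of exactly `|D|!` functions, which cancels the factorial.
  have : (Finset.univ.filter fun f : D → E => Finset.univ.image f ∈ 𝓕) =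
      𝓕.biUnion fun F => Finset.univ.filter fun f : D → E => Finset.univ.image f = F := by
    ext f; simp
  rw [this, Finset.sum_biUnion, Finset.mul_sum, Finset.mul_sum]
  · refine Finset.sum_congr rfl fun F hF => ?_
    rw [← card_functions_with_image F (hcard F hF), ← nsmul_eq_mul, ← Finset.sum_const]
    refine Finset.sum_congr rfl fun f hf => ?_
    have hf' : Finset.univ.image f = F := (Finset.mem_filter.1 hf).2
    have hinj : Function.Injective f := injective_of_card_image (hf' ▸ hcard F hF)
    rw [← hf', Finset.prod_image (fun a _ b _ h => hinj h), mul_comm]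
  · intro F _ F' _ hne
    simp only [Function.onFun, Finset.disjoint_left, Finset.mem_filter]
    rintro f ⟨-, rfl⟩ ⟨-, h⟩
    exact hne h

end Matrix

/-! ### Incidence minors and matrix-tree theorems. -/

namespace FeynmanGraph

open SimpleGraph Matrix

variable {X I E : Type*} (G : FeynmanGraph X I E)

noncomputable section

/-- The start of an edge in an arbitrary orientation. -/
def src (e : E) : X ⊕ I := (Quot.out (G.ends e)).1

/-- The end of an edge in an arbitrary orientation. -/
def tgt (e : E) : X ⊕ I := (Quot.out (G.ends e)).2

theorem ends_eq (e : E) : G.ends e = s(G.src e, G.tgt e) :=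
  (Quot.out_eq (G.ends e)).symm

theorem mem_spanningForests [Fintype E] {p : Set (Set (X ⊕ I))} {F : Finset E} :
    F ∈ G.spanningForests p ↔ G.IsSpanningForest p F := by
  classical
  simp [spanningForests]

variable [DecidableEq X] [DecidableEq I]

/-- The signed incidence matrix. -/
def incidence (R : Type*) [Ring R] : Matrix (X ⊕ I) E R :=
  of fun v e => (if v = G.src e then 1 else 0) - (if v = G.tgt e then 1 else 0)

theorem incidence_apply {R : Type*} [Ring R] (v : X ⊕ I) (e : E) :
    G.incidence R v e = (if v = G.src e then 1 else 0) - (if v = G.tgt e then 1 else 0) := rfl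

/-- The weighted Laplace matrix. -/
def laplacian [Fintype E] [DecidableEq E] (c : E → ℝ) : Matrix (X ⊕ I) (X ⊕ I) ℝ :=
  G.incidence ℝ * diagonal c * (G.incidence ℝ)ᵀ

end

variable [DecidableEq X] [DecidableEq I]

/-- On a union of components of a subgraph, each column of an edge of the subgraph sums to zero. -/
theorem sum_incidence_eq_zero [Fintype X] [Fintype I] {F : Finset E} {e : E} (he : e ∈ F)
    {P : X ⊕ I → Prop} [DecidablePred P]
    (hP : ∀ a b, (G.edgeGraph F).Reachable a b → (P a ↔ P b)) :
    ∑ v, (if P v then G.incidence ℤ v e else 0) = 0 := by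
  have h : P (G.src e) ↔ P (G.tgt e) := by
    by_cases h : G.src e = G.tgt e
    · rw [h]
    · exact hP _ _ (Adj.reachable (G.edgeGraph_adj.2 ⟨⟨e, he, G.ends_eq e⟩, h⟩))
  have h2 : ∀ v, (if P v then G.incidence ℤ v e else 0) =
      (if v = G.src e then (if P (G.src e) then 1 else 0) else 0) -
        (if v = G.tgt e then (if P (G.tgt e) then 1 else 0) else 0) := fun v => by
    rw [incidence_apply]
    grind
  simp only [h2, Finset.sum_sub_distrib, Finset.sum_ite_eq', Finset.mem_univ, if_true, h, sub_self]

variable {D : Type*} [Fintype D] [DecidableEq D] [DecidableEq E]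

/-- Along a walk to `v` from a vertex outside the chosen rows, the signed sum of the traversed
columns restricts to the unit vector at `v`. Hence all unit vectors are integer combinations of
columns and the minor has an integer inverse. -/
theorem isUnit_det_incidence (ι : D → X ⊕ I) (hι : Function.Injective ι) (f : D → E)
    (h : ∀ v, ∃ u, u ∉ Set.range ι ∧ (G.edgeGraph (Finset.univ.image f)).Reachable u v) :
    IsUnit ((G.incidence ℤ).submatrix ι f).det := by
  have key : ∀ v, ∃ z : D → ℤ, ∀ a, (((G.incidence ℤ).submatrix ι f) *ᵥ z) a =
      if ι a = v then 1 else 0 := by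
    intro v
    obtain ⟨u, hu, huv⟩ := h v
    rw [reachable_iff_reflTransGen] at huv
    induction huv with
    | refl =>
      refine ⟨0, fun a => ?_⟩
      rw [if_neg fun ha => hu ⟨a, ha⟩]
      simp
    | @tail b w _ hbw ih =>
      obtain ⟨z, hz⟩ := ih
      obtain ⟨⟨e, he, hends⟩, -⟩ := G.edgeGraph_adj.1 hbw
      obtain ⟨k, -, rfl⟩ := Finset.mem_image.1 he
      rw [G.ends_eq, Sym2.eq_iff] at hends
      rcases hends with ⟨h1, h2⟩ | ⟨h1, h2⟩
      · refine ⟨z - Pi.single k 1, fun a => ?_⟩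
        rw [mulVec_sub, Pi.sub_apply, hz]
        simp [incidence_apply, h1, h2]
      · refine ⟨z + Pi.single k 1, fun a => ?_⟩
        rw [mulVec_add, Pi.add_apply, hz]
        simp [incidence_apply, h1, h2]
  choose z hz using key
  rw [← isUnit_iff_isUnit_det]
  refine IsUnit.of_mul_eq_one (of fun k a => z (ι a) k) ?_
  ext a b
  have := hz (ι b) a
  simp only [mulVec, dotProduct] at this
  simp only [mul_apply, of_apply, this, one_apply, hι.eq_iff]

/-- All vertices of the component of `v` are among the chosen rows, and these rows add up to zero:
the indicator of the component is a left kernel vector. -/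
theorem det_incidence_eq_zero [Fintype X] [Fintype I] (ι : D → X ⊕ I) (hι : Function.Injective ι)
    (f : D → E) {v : X ⊕ I}
    (h : ∀ u, u ∉ Set.range ι → ¬ (G.edgeGraph (Finset.univ.image f)).Reachable u v) :
    ((G.incidence ℤ).submatrix ι f).det = 0 := by
  classical
  rw [← exists_vecMul_eq_zero_iff]
  have hv : v ∈ Set.range ι := by
    by_contra hv
    exact h v hv (Reachable.refl _)
  obtain ⟨a, rfl⟩ := hv
  let P : X ⊕ I → Prop := fun u => (G.edgeGraph (Finset.univ.image f)).Reachable u (ι a)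
  refine ⟨fun b => if P (ι b) then 1 else 0, fun h0 => ?_, ?_⟩
  · have := congrFun h0 a
    simp [P] at this
  · ext k
    have := G.sum_incidence_eq_zero (P := P)
      (Finset.mem_image_of_mem f (Finset.mem_univ k)) fun a b hab =>
        ⟨fun h' => hab.symm.trans h', fun h' => hab.trans h'⟩
    simp only [vecMul, dotProduct, submatrix_apply, ite_mul, one_mul, zero_mul, Pi.zero_apply]
    refine Eq.trans ?_ this
    refine Finset.sum_of_injOn ι hι.injOn (by simp) ?_ (by simp)
    intro u _ hu
    exact if_neg (h u fun ⟨b, hb⟩ => hu ⟨b, by simp, hb⟩)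

omit [DecidableEq E] in
theorem incidence_real_submatrix_det (ι : D → X ⊕ I) (f : D → E) :
    (((G.incidence ℝ).submatrix ι id).submatrix id f).det =
      ((((G.incidence ℤ).submatrix ι f).det : ℤ) : ℝ) := by
  rw [← eq_intCast (Int.castRingHom ℝ), RingHom.map_det]
  congr 1
  ext a b
  simp [incidence_apply]

omit [Fintype D] [DecidableEq D] in
theorem laplacian_submatrix [Fintype E] {D' : Type*} (ι : D → X ⊕ I) (κ : D' → X ⊕ I)
    (c : E → ℝ) :
    (G.laplacian c).submatrix ι κ =
      (G.incidence ℝ).submatrix ι id * diagonal c * ((G.incidence ℝ).submatrix κ id)ᵀ := by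
  ext a b
  simp [laplacian, mul_apply]

/-- The matrix-tree theorem for the Laplacian of the internal vertices. -/
theorem det_laplacian_internal [Fintype X] [Fintype I] [Fintype E] (c : E → ℝ) :
    ((G.laplacian c).submatrix Sum.inr Sum.inr).det =
      G.dualForestPoly (singletonPartition X I) c := by
  rw [laplacian_submatrix, dualForestPoly, ← one_mul (Finset.sum _ _)]
  have hι : Function.Injective (Sum.inr : I → X ⊕ I) := Sum.inr_injective
  refine det_mul_diagonal_mul_transpose_eq_sum _ _ c 1 _ (fun F hF => ?_) fun f => ?_
  · exact ((G.isSpanningForest_singletonPartition_iff F).1 (G.mem_spanningForests.1 hF)).1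
  · rw [incidence_real_submatrix_det]
    have hmem : Finset.univ.image f ∈ G.spanningForests (singletonPartition X I) ↔ _ :=
      G.mem_spanningForests.trans (G.isSpanningForest_singletonPartition_iff _)
    by_cases hinj : Function.Injective f
    · by_cases hr : ∀ v, ∃ k : X, (G.edgeGraph (Finset.univ.image f)).Reachable (Sum.inl k) v
      · rw [if_pos (hmem.2 ⟨by rw [Finset.card_image_of_injective _ hinj, Finset.card_univ], hr⟩)]
        have hu := G.isUnit_det_incidence Sum.inr hι f fun v => by
          obtain ⟨k, hk⟩ := hr v
          exact ⟨Sum.inl k, by simp, hk⟩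
        rcases Int.isUnit_iff.1 hu with h | h <;> simp [h]
      · rw [if_neg fun h => hr (hmem.1 h).2]
        push Not at hr
        obtain ⟨v, hv⟩ := hr
        rw [G.det_incidence_eq_zero Sum.inr hι f (v := v)]
        · simp
        · rintro (k | k) hk
          · exact hv k
          · exact absurd ⟨k, rfl⟩ hk
    · rw [if_neg fun h => hinj (injective_of_card_image (hmem.1 h).1)]
      simp only [Function.Injective] at hinj
      push Not at hinj
      obtain ⟨a, b, hab, hne⟩ := hinj
      rw [det_zero_of_column_eq hne fun k => by simp [hab]]
      simp

/-- The internal vertices together with one external vertex. -/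
def withExternal (i : X) : I ⊕ Unit → X ⊕ I := Sum.elim Sum.inr fun _ => Sum.inl i

omit [DecidableEq X] [DecidableEq I] in
theorem withExternal_injective (i : X) :
    Function.Injective (withExternal i : I ⊕ Unit → X ⊕ I) := by
  rintro (a | a) (b | b) h <;> simp_all [withExternal]

omit [DecidableEq X] [DecidableEq I] in
theorem notMem_range_withExternal (i : X) (u : X ⊕ I) :
    u ∉ Set.range (withExternal i : I ⊕ Unit → X ⊕ I) ↔ ∃ k, k ≠ i ∧ Sum.inl k = u := by
  rcases u with k | k <;> simp [withExternal, eq_comm]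

/-- The rows of the tree containing `i` and `j` add up to zero, and these are its only external
vertices. So the row of `j` is minus the row of `i` minus internal rows, a block triangular change
of rows of determinant `-1`. -/
theorem det_incidence_withExternal [Fintype X] [Fintype I] {i j : X} (hij : i ≠ j)
    (f : I ⊕ Unit → E)
    (hF : G.IsSpanningForest (pairPartition I s(i, j)) (Finset.univ.image f)) :
    ((G.incidence ℤ).submatrix (withExternal j) f).det =
      -((G.incidence ℤ).submatrix (withExternal i) f).det := by
  classical
  let H := G.edgeGraph (Finset.univ.image f)
  let t : Matrix Unit I ℤ := of fun _ v => if H.Reachable (Sum.inl i) (Sum.inr v) then -1 else 0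
  have hT : (G.incidence ℤ).submatrix (withExternal j) f =
      fromBlocks 1 0 t (-1) * (G.incidence ℤ).submatrix (withExternal i) f := by
    ext a k
    rcases a with a | a
    · simp [mul_apply, withExternal, one_apply]
    · have hs := G.sum_incidence_eq_zero (P := fun v => H.Reachable (Sum.inl i) v)
        (Finset.mem_image_of_mem f (Finset.mem_univ k)) fun a b hab =>
          ⟨fun h' => h'.trans hab, fun h' => h'.trans hab.symm⟩
      have hr := G.reachable_iff_of_isSpanningForest_pairPartition hij hF
      rw [Fintype.sum_sum_type] at hs
      simp only [H, hr] at hs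
      rw [← Finset.sum_filter, Finset.filter_or, Finset.filter_eq', Finset.filter_eq',
        if_pos (Finset.mem_univ _), if_pos (Finset.mem_univ _),
        Finset.sum_union (by simpa using hij), Finset.sum_singleton, Finset.sum_singleton] at hs
      simp only [mul_apply, withExternal, Fintype.sum_sum_type, submatrix_apply, Sum.elim_inr,
        Sum.elim_inl, fromBlocks_apply₂₁, fromBlocks_apply₂₂, t, of_apply, ite_mul, zero_mul,
        neg_mul, one_mul, neg_apply, one_apply, Finset.univ_unique, Finset.sum_singleton,
        if_true, H, Subsingleton.elim a default]
      have h2 : ∑ x : I, (if (G.edgeGraph (Finset.univ.image f)).Reachable (Sum.inl i) (Sum.inr x)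
            then -G.incidence ℤ (Sum.inr x) (f k) else 0) =
          - ∑ x : I, (if (G.edgeGraph (Finset.univ.image f)).Reachable (Sum.inl i) (Sum.inr x)
            then G.incidence ℤ (Sum.inr x) (f k) else 0) := by
        rw [← Finset.sum_neg_distrib]
        exact Finset.sum_congr rfl fun x _ => by split_ifs <;> simp
      rw [h2]
      linarith
  rw [hT, det_mul, det_fromBlocks_zero₁₂]
  simp

/-- The all-minors matrix-tree theorem for two external vertices. -/
theorem det_laplacian_withExternal [Fintype X] [Fintype I] [Fintype E] (c : E → ℝ) {i j : X}
    (hij : i ≠ j) :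
    ((G.laplacian c).submatrix (withExternal i) (withExternal j)).det =
      -G.dualForestPoly (pairPartition I s(i, j)) c := by
  rw [laplacian_submatrix, dualForestPoly, ← neg_one_mul]
  have hcard : Fintype.card (I ⊕ Unit) = Fintype.card I + 1 := by simp
  refine det_mul_diagonal_mul_transpose_eq_sum _ _ c (-1) _ (fun F hF => ?_) fun f => ?_
  · rw [hcard]
    exact ((G.isSpanningForest_pairPartition_iff hij F).1 (G.mem_spanningForests.1 hF)).1
  · rw [incidence_real_submatrix_det, incidence_real_submatrix_det]
    have hmem : Finset.univ.image f ∈ G.spanningForests (pairPartition I s(i, j)) ↔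
        G.IsSpanningForest (pairPartition I s(i, j)) (Finset.univ.image f) :=
      G.mem_spanningForests
    have hiff := G.isSpanningForest_pairPartition_iff hij (Finset.univ.image f)
    have hzero : ∀ l : X, ¬ (∀ v, ∃ k : X, k ≠ l ∧
        (G.edgeGraph (Finset.univ.image f)).Reachable (Sum.inl k) v) →
        ((G.incidence ℤ).submatrix (withExternal l) f).det = 0 := by
      intro l hl
      push Not at hl
      obtain ⟨v, hv⟩ := hl
      refine G.det_incidence_eq_zero _ (withExternal_injective l) f (v := v) fun u hu => ?_
      obtain ⟨k, hk, rfl⟩ := (notMem_range_withExternal l u).1 hu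
      exact hv k hk
    by_cases hinj : Function.Injective f
    · by_cases hi : ∀ v, ∃ k : X, k ≠ i ∧
          (G.edgeGraph (Finset.univ.image f)).Reachable (Sum.inl k) v
      · by_cases hj : ∀ v, ∃ k : X, k ≠ j ∧
            (G.edgeGraph (Finset.univ.image f)).Reachable (Sum.inl k) v
        · have hF := hiff.2 ⟨by rw [Finset.card_image_of_injective _ hinj, Finset.card_univ, hcard],
            hi, hj⟩
          rw [if_pos (hmem.2 hF), G.det_incidence_withExternal hij f hF]
          have hu := G.isUnit_det_incidence _ (withExternal_injective i) f fun v => by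
            obtain ⟨k, hk, hkv⟩ := hi v
            exact ⟨Sum.inl k, (notMem_range_withExternal i _).2 ⟨k, hk, rfl⟩, hkv⟩
          rcases Int.isUnit_iff.1 hu with h | h <;> simp [h]
        · rw [if_neg fun h => hj (hiff.1 (hmem.1 h)).2.2, hzero j hj]
          simp
      · rw [if_neg fun h => hi (hiff.1 (hmem.1 h)).2.1, hzero i hi]
        simp
    · rw [if_neg fun h => hinj (injective_of_card_image
        ((hiff.1 (hmem.1 h)).1.trans hcard.symm))]
      simp only [Function.Injective] at hinj
      push Not at hinj
      obtain ⟨a, b, hab, hne⟩ := hinj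
      rw [det_zero_of_column_eq hne fun k => by simp [hab]]
      simp

end FeynmanGraph

/-! ### Quadratic forms with vanishing row sums. -/

theorem Sym2.two_mul_sum_not_isDiag {A : Type*} [Fintype A] [DecidableEq A] (h : Sym2 A → ℝ)
    (hdiag : ∀ a, h s(a, a) = 0) :
    2 * ∑ z : Sym2 A with ¬ z.IsDiag, h z = ∑ i, ∑ j, h s(i, j) := by
  rw [← Fintype.sum_prod_type' (f := fun i j => h s(i, j)),
    ← Finset.sum_fiberwise Finset.univ (fun p : A × A => s(p.1, p.2)), Finset.mul_sum,
    Finset.sum_filter]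
  refine Finset.sum_congr rfl fun z _ => ?_
  have hc : ∑ p : A × A with s(p.1, p.2) = z, h s(p.1, p.2) =
      ∑ p : A × A with s(p.1, p.2) = z, h z :=
    Finset.sum_congr rfl fun p hp => by rw [(Finset.mem_filter.1 hp).2]
  rw [hc, Finset.sum_const, nsmul_eq_mul]
  induction z with
  | _ a b =>
    by_cases hab : a = b
    · subst hab
      simp [hdiag]
    · rw [if_pos (by simpa using hab)]
      congr 1
      have : (Finset.univ.filter fun p : A × A => s(p.1, p.2) = s(a, b)) = {(a, b), (b, a)} := by
        ext ⟨u, v⟩; simp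
      rw [this, Finset.card_pair (by simpa using fun h _ => hab h)]
      norm_num

namespace Matrix

/-- Zero row sums allow `ξ j` to be replaced by `ξ j - ξ i`, which removes the diagonal; adding the
same identity with `i` and `j` exchanged produces the squares. -/
theorem dotProduct_mulVec_eq_neg_sum {A : Type*} [Fintype A] [DecidableEq A] (S : Matrix A A ℝ)
    (hrow : S *ᵥ 1 = 0) (T : Sym2 A → ℝ) (hT : ∀ i j, i ≠ j → S i j = -T s(i, j)) (ξ : A → ℝ) :
    ξ ⬝ᵥ S *ᵥ ξ = ∑ z : Sym2 A with ¬ z.IsDiag,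
      Sym2.lift ⟨fun i j => (ξ i - ξ j) ^ 2, fun i j => by ring⟩ z * T z := by
  have h1 := Sym2.two_mul_sum_not_isDiag (fun z : Sym2 A =>
    Sym2.lift ⟨fun i j => (ξ i - ξ j) ^ 2, fun i j => by ring⟩ z * T z) (by simp)
  simp only [Sym2.lift_mk] at h1
  have h2 : ξ ⬝ᵥ S *ᵥ ξ = ∑ i, ∑ j, ξ i * (ξ i - ξ j) * T s(i, j) := by
    simp only [dotProduct, mulVec]
    refine Finset.sum_congr rfl fun i _ => ?_
    have hr := congrFun hrow i
    simp only [mulVec, dotProduct, Pi.one_apply, mul_one, Pi.zero_apply] at hr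
    have h3 : ∑ j, S i j * ξ j = ∑ j, S i j * (ξ j - ξ i) := by
      simp only [mul_sub, Finset.sum_sub_distrib, ← Finset.sum_mul, hr]
      ring
    rw [h3, Finset.mul_sum]
    refine Finset.sum_congr rfl fun j _ => ?_
    by_cases hij : i = j
    · simp [hij]
    · rw [hT i j hij]; ring
  have h3 : ξ ⬝ᵥ S *ᵥ ξ = ∑ i, ∑ j, ξ j * (ξ j - ξ i) * T s(i, j) := by
    rw [h2, Finset.sum_comm]
    simp only [Sym2.eq_swap]
  have h4 : 2 * (ξ ⬝ᵥ S *ᵥ ξ) = ∑ i, ∑ j, (ξ i - ξ j) ^ 2 * T s(i, j) := by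
    rw [two_mul]
    nth_rw 1 [h2]
    rw [h3, ← Finset.sum_add_distrib]
    refine Finset.sum_congr rfl fun i _ => ?_
    rw [← Finset.sum_add_distrib]
    exact Finset.sum_congr rfl fun j _ => by ring
  linarith

end Matrix

/-! ### The network energy and its Schur complement. -/

namespace FeynmanGraph

open SimpleGraph Matrix

variable {X I E : Type*} (G : FeynmanGraph X I E)

variable [DecidableEq X] [DecidableEq I] [DecidableEq E] [Fintype E]

theorem laplacian_transpose (c : E → ℝ) : (G.laplacian c)ᵀ = G.laplacian c := by
  simp [laplacian, transpose_mul, Matrix.mul_assoc]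

variable [Fintype X] [Fintype I]

omit [DecidableEq E] [Fintype E] in
theorem incidence_transpose_mulVec (y : X ⊕ I → ℝ) (e : E) :
    ((G.incidence ℝ)ᵀ *ᵥ y) e = y (G.src e) - y (G.tgt e) := by
  simp only [mulVec, dotProduct, transpose_apply, incidence_apply, sub_mul, ite_mul, one_mul,
    zero_mul, Finset.sum_sub_distrib, Finset.sum_ite_eq', Finset.mem_univ,
    if_true]

theorem laplacian_mulVec (c : E → ℝ) (y : X ⊕ I → ℝ) :
    G.laplacian c *ᵥ y = G.incidence ℝ *ᵥ fun e => c e * (y (G.src e) - y (G.tgt e)) := by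
  rw [laplacian, ← mulVec_mulVec, ← mulVec_mulVec]
  congr 1
  ext e
  rw [mulVec_diagonal, incidence_transpose_mulVec]

theorem dotProduct_laplacian_mulVec (c : E → ℝ) (y : X ⊕ I → ℝ) :
    y ⬝ᵥ G.laplacian c *ᵥ y = ∑ e, c e * (y (G.src e) - y (G.tgt e)) ^ 2 := by
  rw [laplacian_mulVec, dotProduct_mulVec, ← mulVec_transpose, dotProduct]
  refine Finset.sum_congr rfl fun e _ => ?_
  rw [incidence_transpose_mulVec]
  ring

theorem posSemidef_laplacian_internal {c : E → ℝ} (hc : ∀ e, 0 ≤ c e) :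
    ((G.laplacian c).submatrix Sum.inr Sum.inr).PosSemidef := by
  refine PosSemidef.submatrix (.of_dotProduct_mulVec_nonneg ?_ fun y => ?_) Sum.inr
  · rw [IsHermitian, conjTranspose_eq_transpose_of_trivial, laplacian_transpose]
  · rw [star_trivial, dotProduct_laplacian_mulVec]
    exact Finset.sum_nonneg fun e _ => mul_nonneg (hc e) (sq_nonneg _)

/-- Completing the square in the energy of a network whose external potentials are fixed. -/
theorem exists_energy_eq (c : E → ℝ)
    (hdet : G.dualForestPoly (singletonPartition X I) c ≠ 0) (ξ : X → ℝ) :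
    ∃ w₀ : I → ℝ, ∀ w : I → ℝ,
      ∑ e, c e * (Sum.elim ξ w (G.src e) - Sum.elim ξ w (G.tgt e)) ^ 2 =
        (w - w₀) ⬝ᵥ ((G.laplacian c).submatrix Sum.inr Sum.inr) *ᵥ (w - w₀) +
        (∑ z : Sym2 X with ¬ z.IsDiag,
          Sym2.lift ⟨fun i j => (ξ i - ξ j) ^ 2, fun i j => by ring⟩ z *
            G.dualForestPoly (pairPartition I z) c) /
          G.dualForestPoly (singletonPartition X I) c := by
  set L := G.laplacian c with hL
  set A := L.submatrix (Sum.inr : I → X ⊕ I) Sum.inr with hA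
  set B := L.submatrix (Sum.inr : I → X ⊕ I) (Sum.inl : X → X ⊕ I) with hB
  set D := L.submatrix (Sum.inl : X → X ⊕ I) Sum.inl with hD
  have hAdet : A.det = G.dualForestPoly (singletonPartition X I) c := G.det_laplacian_internal c
  have hLsymm : ∀ a b, L a b = L b a := fun a b => by
    conv_lhs => rw [hL, ← laplacian_transpose]
    rfl
  have hAh : A.IsHermitian := by
    ext a b
    simp [hA, hLsymm (Sum.inr a)]
  have hBh : Bᴴ = L.submatrix (Sum.inl : X → X ⊕ I) Sum.inr := by
    ext a b
    simp [hB, hLsymm (Sum.inl a)]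
  have hunit : IsUnit A.det := by
    rw [hAdet]
    exact hdet.isUnit
  let _ : Invertible A := A.invertibleOfIsUnitDet hunit
  -- The effective Laplacian on the external vertices once the internal ones are eliminated.
  set S := D - Bᴴ * A⁻¹ * B with hS
  have hblock : fromBlocks A B Bᴴ D = L.submatrix Sum.swap Sum.swap := by
    rw [hBh]
    ext (a | a) (b | b) <;> rfl
  -- Constants lie in the kernel of the Laplacian, and elimination preserves this.
  have hrow : S *ᵥ 1 = 0 := by
    have h0 : L *ᵥ 1 = 0 := by
      rw [hL, laplacian_mulVec]
      simp only [Pi.one_apply, sub_self, mul_zero]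
      exact mulVec_zero _
    have h1 : B *ᵥ 1 = -(A *ᵥ 1) := by
      ext a
      have := congrFun h0 (Sum.inr a)
      simp only [mulVec, dotProduct, Fintype.sum_sum_type, Pi.one_apply, mul_one,
        Pi.zero_apply] at this
      simp only [mulVec, dotProduct, hA, hB, Pi.neg_apply, Pi.one_apply, submatrix_apply, mul_one]
      linarith
    have h2 : D *ᵥ 1 = -(Bᴴ *ᵥ 1) := by
      rw [hBh]
      ext a
      have := congrFun h0 (Sum.inl a)
      simp only [mulVec, dotProduct, Fintype.sum_sum_type, Pi.one_apply, mul_one,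
        Pi.zero_apply] at this
      simp only [mulVec, dotProduct, hD, Pi.neg_apply, Pi.one_apply, submatrix_apply, mul_one]
      linarith
    rw [hS, sub_mulVec, h2, ← mulVec_mulVec, h1, mulVec_neg, mulVec_mulVec, Matrix.mul_assoc,
      nonsing_inv_mul _ hunit, Matrix.mul_one]
    simp
  -- Bordering `A` by the row of `i` and the column of `j` gives determinant `A.det * S i j`, the
  -- minor of the all-minors theorem.
  have hoff : ∀ i j, i ≠ j → S i j = -(G.dualForestPoly (pairPartition I s(i, j)) c /
      G.dualForestPoly (singletonPartition X I) c) := by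
    intro i j hij
    have h1 := G.det_laplacian_withExternal c hij
    have h2 : (G.laplacian c).submatrix (withExternal i : I ⊕ Unit → X ⊕ I) (withExternal j) =
        fromBlocks A (B.submatrix id fun _ => j) (Bᴴ.submatrix (fun _ => i) id)
          (D.submatrix (fun _ => i) fun _ => j) := by
      rw [hBh]
      ext (a | a) (b | b) <;> rfl
    rw [h2, det_fromBlocks₁₁, hAdet, invOf_eq_nonsing_inv] at h1
    rw [← neg_div, eq_div_iff hdet, ← h1, mul_comm]
    congr 1
    rw [det_unique]
    simp [hS, mul_apply]
  -- The equilibrium potential: the solution of `A w₀ + B ξ = 0`.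
  refine ⟨-((A⁻¹ * B) *ᵥ ξ), fun w => ?_⟩
  have hq := dotProduct_mulVec_eq_neg_sum S hrow
    (fun z => G.dualForestPoly (pairPartition I z) c /
      G.dualForestPoly (singletonPartition X I) c) hoff ξ
  have hs := schur_complement_eq₁₁ B D w ξ hAh
  rw [hblock] at hs
  simp only [star_trivial, ← dotProduct_mulVec] at hs
  have he : Sum.elim w ξ ⬝ᵥ L.submatrix Sum.swap Sum.swap *ᵥ Sum.elim w ξ =
      Sum.elim ξ w ⬝ᵥ L *ᵥ Sum.elim ξ w := by
    simp only [dotProduct, mulVec, Fintype.sum_sum_type, submatrix_apply, Sum.swap_inl,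
      Sum.swap_inr, Sum.elim_inl, Sum.elim_inr]
    rw [add_comm]
    congr 1 <;> exact Finset.sum_congr rfl fun a _ => by rw [add_comm]
  rw [← dotProduct_laplacian_mulVec, ← hL, ← he, hs, hq, sub_neg_eq_add, Finset.sum_div]
  simp only [mul_div_assoc]

end FeynmanGraph

/-! ### Tonelli for products, exchange of indices, translation invariance. -/

namespace MeasureTheory

/-- Tonelli's theorem for a product of functions of one variable each. -/
theorem lintegral_prod_eval_eq_prod {ι : Type*} [Fintype ι] {α : ι → Type*}
    [∀ i, MeasurableSpace (α i)] (μ : ∀ i, Measure (α i)) [∀ i, SigmaFinite (μ i)]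
    (f : ∀ i, α i → ℝ≥0∞) (hf : ∀ i, Measurable (f i)) :
    ∫⁻ x, ∏ i, f i (x i) ∂Measure.pi μ = ∏ i, ∫⁻ t, f i t ∂μ i := by
  classical
  have hmeas : Measurable fun x : ∀ i, α i => ∏ i, f i (x i) :=
    Finset.measurable_fun_prod _ fun i _ => (hf i).comp (measurable_pi_apply i)
  have key : ∀ (s : Finset ι) (x : ∀ i, α i), (∫⋯∫⁻_s, (fun x => ∏ i, f i (x i)) ∂μ) x =
      (∏ i ∈ s, ∫⁻ t, f i t ∂μ i) * ∏ i ∈ sᶜ, f i (x i) := by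
    intro s
    induction s using Finset.induction_on with
    | empty => intro x; simp
    | insert i s hi ih =>
      intro x
      rw [lmarginal_insert _ hmeas hi]
      have h1 : ∀ t, (∏ j ∈ sᶜ, f j (Function.update x i t j)) =
          f i t * ∏ j ∈ (insert i s)ᶜ, f j (x j) := by
        intro t
        have : sᶜ = insert i (insert i s)ᶜ := by
          ext j; simp; grind
        rw [this, Finset.prod_insert (by simp)]
        simp only [Function.update_self]
        congr 1
        refine Finset.prod_congr rfl fun j hj => ?_
        have hji : j ≠ i := by rintro rfl; simp at hj
        rw [Function.update_of_ne hji]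
      simp only [ih, h1]
      rw [lintegral_const_mul _ ((hf i).mul_const _), lintegral_mul_const _ (hf i),
        Finset.prod_insert hi]
      ring
  by_cases hne : Nonempty (∀ i, α i)
  · obtain ⟨x⟩ := hne
    rw [lintegral_eq_lmarginal_univ x, key]
    simp
  · have : ∃ i, IsEmpty (α i) := by
      by_contra h
      push Not at h
      exact hne (Classical.nonempty_pi.2 h)
    obtain ⟨i, hi⟩ := this
    have : IsEmpty (∀ i, α i) := not_nonempty_iff.1 hne
    rw [lintegral_of_isEmpty]
    symm
    exact Finset.prod_eq_zero (Finset.mem_univ i) (lintegral_of_isEmpty _ _)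

/-- Both measures agree on boxes whose sides are boxes, and these generate. The exchange of vertex
and coordinate indices lets the internal integral factor over the `d` coordinates. -/
theorem measurePreserving_pi_swap (I K : Type*) [Fintype I] [Fintype K] :
    MeasurePreserving (fun (w : I → K → ℝ) k i => w i k) := by
  have hm : Measurable (fun (w : I → K → ℝ) k i => w i k) := by fun_prop
  refine ⟨hm, ?_⟩
  symm
  have hC : ∀ _ : K, MeasurableSpace.generateFrom
      (Set.pi Set.univ '' Set.pi Set.univ fun _ : I => {s : Set ℝ | MeasurableSet s}) =
        MeasurableSpace.pi := fun _ => generateFrom_pi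
  refine Measure.pi_eq_generateFrom (μ := fun _ : K => (volume : Measure (I → ℝ))) hC
    (fun _ => isPiSystem_pi)
    (fun _ => Measure.FiniteSpanningSetsIn.pi fun _ => (volume : Measure ℝ).toFiniteSpanningSetsIn)
    ?_
  intro s hs
  choose t ht hts using hs
  have htm : ∀ k i, MeasurableSet (t k i) := fun k i => ht k i (Set.mem_univ i)
  have hpre : (fun (w : I → K → ℝ) k i => w i k) ⁻¹' (Set.univ.pi s) =
      Set.univ.pi fun i => Set.univ.pi fun k => t k i := by
    ext w
    simp only [← hts, Set.mem_preimage, Set.mem_pi, Set.mem_univ, true_imp_iff]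
    exact forall_comm
  have hsm : MeasurableSet (Set.univ.pi s) := MeasurableSet.univ_pi fun k => by
    rw [← hts k]
    exact MeasurableSet.univ_pi fun i => htm k i
  rw [Measure.map_apply hm hsm, hpre]
  simp only [← hts, volume_pi_pi]
  exact Finset.prod_comm

/-- The slabs `⌊w i / v i⌋ = n` tile the space, and translation by multiples of `v` gives them all
the same nonzero mass. -/
theorem lintegral_eq_top_of_translation_invariant {I : Type*} [Fintype I] {h : (I → ℝ) → ℝ≥0∞}
    (hm : Measurable h) (hpos : ∀ w, h w ≠ 0) {v : I → ℝ} (hv : v ≠ 0)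
    (hinv : ∀ (a : ℝ) w, h (w + a • v) = h w) : ∫⁻ w, h w = ∞ := by
  obtain ⟨i, hi⟩ := Function.ne_iff.1 hv
  simp only [Pi.zero_apply] at hi
  let S : ℤ → Set (I → ℝ) := fun n => {w | ⌊w i / v i⌋ = n}
  have hS : ∀ n, MeasurableSet (S n) := fun n =>
    measurableSet_eq_fun (f := fun w : I → ℝ => ⌊w i / v i⌋)
      (Int.measurable_floor.comp ((measurable_pi_apply i).div_const _)) measurable_const
  have hconst : ∀ n, ∫⁻ w in S n, h w = ∫⁻ w in S 0, h w := by
    intro n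
    rw [← lintegral_indicator (hS n), ← lintegral_indicator (hS 0),
      ← lintegral_add_right_eq_self _ ((n : ℝ) • v)]
    refine lintegral_congr fun w => ?_
    have : w + (n : ℝ) • v ∈ S n ↔ w ∈ S 0 := by
      simp [S, add_div, hi]
    by_cases hw : w ∈ S 0
    · rw [Set.indicator_of_mem (this.2 hw), Set.indicator_of_mem hw, hinv]
    · rw [Set.indicator_of_notMem (mt this.1 hw), Set.indicator_of_notMem hw]
  have h0 : ∫⁻ w in S 0, h w ≠ 0 := by
    rw [← pos_iff_ne_zero, setLIntegral_pos_iff hm]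
    have hsupp : Function.support h = Set.univ := Set.eq_univ_of_forall hpos
    rw [hsupp, Set.univ_inter]
    have hopen : IsOpen {w : I → ℝ | w i / v i ∈ Set.Ioo (0 : ℝ) 1} :=
      isOpen_Ioo.preimage (by fun_prop)
    refine lt_of_lt_of_le (hopen.measure_pos volume ⟨(1 / 2 : ℝ) • v, ?_⟩)
      (measure_mono fun w hw => ?_)
    · simp only [Set.mem_ofPred_eq, Pi.smul_apply, smul_eq_mul, mul_div_cancel_right₀ _ hi,
        Set.mem_Ioo]
      norm_num
    · exact Int.floor_eq_zero_iff.2 ⟨hw.1.le, hw.2⟩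
  rw [eq_top_iff, ← ENNReal.tsum_const_eq_top_of_ne_zero (α := ℤ) h0]
  calc ∑' _ : ℤ, ∫⁻ w in S 0, h w = ∑' n : ℤ, ∫⁻ w in S n, h w := by simp only [hconst]
    _ = ∫⁻ w in ⋃ n, S n, h w := by
        refine (lintegral_iUnion hS ?_ _).symm
        intro m n hmn
        exact Set.disjoint_left.2 fun w hw hw' => hmn (hw.symm.trans hw')
    _ ≤ ∫⁻ w, h w := setLIntegral_le_lintegral _ _

end MeasureTheory

/-! ### Gaussian integrals. -/

open MeasureTheory Matrix

theorem lintegral_exp_neg_dotProduct_self {I : Type*} [Fintype I] :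
    ∫⁻ y : I → ℝ, ENNReal.ofReal (Real.exp (-(y ⬝ᵥ y))) =
      ENNReal.ofReal (√Real.pi ^ Fintype.card I) := by
  have h1 : ∀ y : I → ℝ, ENNReal.ofReal (Real.exp (-(y ⬝ᵥ y))) =
      ∏ i, ENNReal.ofReal (Real.exp (-1 * y i ^ 2)) := fun y => by
    rw [← ENNReal.ofReal_prod_of_nonneg fun i _ => (Real.exp_pos _).le, ← Real.exp_sum,
      dotProduct, ← Finset.sum_neg_distrib]
    simp [sq]
  have h2 : ∫⁻ t : ℝ, ENNReal.ofReal (Real.exp (-1 * t ^ 2)) = ENNReal.ofReal √Real.pi := by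
    rw [← ofReal_integral_eq_lintegral_ofReal (integrable_exp_neg_mul_sq one_pos)
      (Filter.Eventually.of_forall fun _ => (Real.exp_pos _).le), integral_gaussian, div_one]
  simp only [h1]
  rw [volume_pi, lintegral_prod_eval_eq_prod _ (fun _ t => ENNReal.ofReal (Real.exp (-1 * t ^ 2)))
    fun _ => by fun_prop]
  simp only [h2, Finset.prod_const, Finset.card_univ]
  rw [ENNReal.ofReal_pow (Real.sqrt_nonneg _)]

/-- Write `A = Mᵀ * M` and substitute `z = M y`, whose Jacobian is `√A.det`. -/
theorem Matrix.PosDef.lintegral_exp_neg {I : Type*} [Fintype I] [DecidableEq I]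
    {A : Matrix I I ℝ} (hA : A.PosDef) :
    ∫⁻ y : I → ℝ, ENNReal.ofReal (Real.exp (-(y ⬝ᵥ A *ᵥ y))) =
      ENNReal.ofReal (√Real.pi ^ Fintype.card I * (√A.det)⁻¹) := by
  obtain ⟨M, rfl⟩ : ∃ M : Matrix I I ℝ, A = Mᵀ * M := by
    open scoped MatrixOrder in
    obtain ⟨M, hM⟩ := CStarAlgebra.nonneg_iff_eq_star_mul_self.mp hA.posSemidef.nonneg
    exact ⟨M, by rw [hM, star_eq_conjTranspose, conjTranspose_eq_transpose_of_trivial]⟩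
  have hdet : (Mᵀ * M).det = M.det ^ 2 := by rw [det_mul, det_transpose, sq]
  have hM : M.det ≠ 0 := by
    have := hA.det_pos
    rw [hdet] at this
    exact fun h => by simp [h] at this
  have h1 : ∀ y : I → ℝ, y ⬝ᵥ (Mᵀ * M) *ᵥ y = toLin' M y ⬝ᵥ toLin' M y := fun y => by
    rw [← mulVec_mulVec, dotProduct_mulVec, vecMul_transpose, toLin'_apply]
  have hmeas : Measurable (toLin' M) := (toLin' M).continuous_of_finiteDimensional.measurable
  simp only [h1]
  rw [← lintegral_map (μ := volume)
    (f := fun z : I → ℝ => ENNReal.ofReal (Real.exp (-(z ⬝ᵥ z))))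
    (by simp only [dotProduct]; fun_prop) hmeas, Real.map_matrix_volume_pi_eq_smul_volume_pi hM,
    lintegral_smul_measure, lintegral_exp_neg_dotProduct_self, hdet, Real.sqrt_sq_eq_abs,
    smul_eq_mul, ← ENNReal.ofReal_mul (abs_nonneg _), abs_inv, mul_comm]

/-! ### Integrating out the internal vertices. -/

namespace FeynmanGraph

variable {X I E : Type*} (G : FeynmanGraph X I E)

variable [DecidableEq X] [DecidableEq I] [DecidableEq E] [Fintype E] [Fintype X] [Fintype I]

omit [DecidableEq X] [DecidableEq I] [DecidableEq E] [Fintype X] [Fintype I] in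
theorem dualForestPoly_nonneg (p : Set (Set (X ⊕ I))) {c : E → ℝ} (hc : ∀ e, 0 ≤ c e) :
    0 ≤ G.dualForestPoly p c :=
  Finset.sum_nonneg fun _ _ => Finset.prod_nonneg fun e _ => hc e

/-- The Gaussian integral over the internal vertices in dimension one. -/
theorem lintegral_exp_neg_energy {c : E → ℝ} (hc : ∀ e, 0 < c e) (ξ : X → ℝ) :
    ∫⁻ w : I → ℝ, ENNReal.ofReal (Real.exp
        (-∑ e, c e * (Sum.elim ξ w (G.src e) - Sum.elim ξ w (G.tgt e)) ^ 2)) =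
      if G.dualForestPoly (singletonPartition X I) c = 0 then ∞ else
        ENNReal.ofReal (√Real.pi ^ Fintype.card I *
          (√(G.dualForestPoly (singletonPartition X I) c))⁻¹ *
          Real.exp (-((∑ z : Sym2 X with ¬ z.IsDiag,
            Sym2.lift ⟨fun i j => (ξ i - ξ j) ^ 2, fun i j => by ring⟩ z *
              G.dualForestPoly (pairPartition I z) c) /
            G.dualForestPoly (singletonPartition X I) c))) := by
  have hpsd := G.posSemidef_laplacian_internal fun e => (hc e).le
  have hdet := G.det_laplacian_internal c
  set A := (G.laplacian c).submatrix (Sum.inr : I → X ⊕ I) Sum.inr with hA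
  split_ifs with h0
  -- A kernel vector, extended by zero to the external vertices, has zero energy and so takes equal
  -- values at the ends of every edge. Translation by it leaves the integrand unchanged.
  · obtain ⟨v, hv, hAv⟩ := exists_mulVec_eq_zero_iff.2 (hdet.trans h0)
    have hzero : ∀ e, Sum.elim (0 : X → ℝ) v (G.src e) = Sum.elim (0 : X → ℝ) v (G.tgt e) := by
      have h1 := G.dotProduct_laplacian_mulVec c (Sum.elim 0 v)
      have h2 : Sum.elim 0 v ⬝ᵥ G.laplacian c *ᵥ Sum.elim 0 v = v ⬝ᵥ A *ᵥ v := by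
        simp [dotProduct, mulVec, Fintype.sum_sum_type, hA]
      rw [h2, hAv, dotProduct_zero, eq_comm,
        Finset.sum_eq_zero_iff_of_nonneg fun e _ => mul_nonneg (hc e).le (sq_nonneg _)] at h1
      intro e
      have := h1 e (Finset.mem_univ e)
      rw [mul_eq_zero, or_iff_right (hc e).ne', sq_eq_zero_iff, sub_eq_zero] at this
      exact this
    have hmeas : ∀ u : X ⊕ I, Measurable fun w : I → ℝ => Sum.elim ξ w u := by
      rintro (u | u)
      · exact measurable_const
      · exact measurable_pi_apply u
    refine lintegral_eq_top_of_translation_invariant ?_ (fun w => ?_) hv fun a w => ?_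
    · refine ENNReal.measurable_ofReal.comp (Real.measurable_exp.comp (Measurable.neg ?_))
      exact Finset.measurable_fun_sum _ fun e _ =>
        (((hmeas _).sub (hmeas _)).pow_const 2).const_mul _
    · simpa using Real.exp_pos _
    · have h3 : ∀ u : X ⊕ I, Sum.elim ξ (w + a • v) u =
          Sum.elim ξ w u + a * Sum.elim (0 : X → ℝ) v u := by
        rintro (u | u) <;> simp
      simp only [h3, hzero, add_sub_add_right_eq_sub]
  · have hpd : A.PosDef := hpsd.posDef_iff_det_ne_zero.2 (hdet ▸ h0)
    obtain ⟨w₀, hw₀⟩ := G.exists_energy_eq c h0 ξ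
    simp only [hw₀, neg_add, Real.exp_add, ENNReal.ofReal_mul (Real.exp_pos _).le]
    rw [lintegral_mul_const' _ _ ENNReal.ofReal_ne_top,
      lintegral_sub_right_eq_self
        (fun w : I → ℝ => ENNReal.ofReal (Real.exp (-(w ⬝ᵥ A *ᵥ w)))) w₀,
      hpd.lintegral_exp_neg, hdet, ← ENNReal.ofReal_mul (by positivity)]

theorem sqDist_mk {A : Type*} {d : ℕ} (y : A → EuclideanSpace ℝ (Fin d)) (u v : A) :
    sqDist y s(u, v) = ∑ k, (y u k - y v k) ^ 2 := by
  simp [sqDist, EuclideanSpace.norm_sq_eq]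

/-- The Gaussian integral over the internal vertices. -/
theorem lintegral_exp_neg_sqDist {d : ℕ} (hd : 0 < d) {c : E → ℝ} (hc : ∀ e, 0 < c e)
    (x : X → EuclideanSpace ℝ (Fin d)) :
    ∫⁻ w : I → EuclideanSpace ℝ (Fin d), ENNReal.ofReal (Real.exp
        (-∑ e, c e * sqDist (Sum.elim x w) (G.ends e))) =
      if G.dualForestPoly (singletonPartition X I) c = 0 then ∞ else
        ENNReal.ofReal ((Real.pi ^ ((d : ℝ) / 2)) ^ Fintype.card I *
          (G.dualForestPoly (singletonPartition X I) c ^ ((d : ℝ) / 2))⁻¹ *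
          Real.exp (-((∑ z : Sym2 X with ¬ z.IsDiag,
            sqDist x z * G.dualForestPoly (pairPartition I z) c) /
            G.dualForestPoly (singletonPartition X I) c))) := by
  let g : Fin d → (I → ℝ) → ℝ≥0∞ := fun k w => ENNReal.ofReal (Real.exp
    (-∑ e, c e * (Sum.elim (fun i => x i k) w (G.src e) -
      Sum.elim (fun i => x i k) w (G.tgt e)) ^ 2))
  have hg : ∀ k, Measurable (g k) := by
    intro k
    have hmeas : ∀ u : X ⊕ I, Measurable fun w : I → ℝ => Sum.elim (fun i => x i k) w u := by
      rintro (u | u)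
      · exact measurable_const
      · exact measurable_pi_apply u
    refine ENNReal.measurable_ofReal.comp (Real.measurable_exp.comp (Measurable.neg ?_))
    exact Finset.measurable_fun_sum _ fun e _ =>
      (((hmeas _).sub (hmeas _)).pow_const 2).const_mul _
  have hfac : ∀ w : I → EuclideanSpace ℝ (Fin d), ENNReal.ofReal (Real.exp
      (-∑ e, c e * sqDist (Sum.elim x w) (G.ends e))) = ∏ k, g k fun i => w i k := by
    intro w
    rw [← ENNReal.ofReal_prod_of_nonneg fun _ _ => (Real.exp_pos _).le, ← Real.exp_sum]
    congr 2
    rw [Finset.sum_neg_distrib, Finset.sum_comm]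
    congr 1
    refine Finset.sum_congr rfl fun e _ => ?_
    rw [G.ends_eq e, sqDist_mk, Finset.mul_sum]
    have h4 : ∀ (u : X ⊕ I) (k : Fin d), Sum.elim x w u k =
        Sum.elim (fun i => x i k) (fun i => w i k) u := by
      rintro (u | u) k <;> rfl
    simp only [h4]
  have hswap : ∫⁻ w : I → EuclideanSpace ℝ (Fin d), ∏ k, g k (fun i => w i k) =
      ∏ k, ∫⁻ y : I → ℝ, g k y := by
    rw [← lintegral_prod_eval_eq_prod (fun _ : Fin d => (volume : Measure (I → ℝ))) g hg,
      ← volume_pi, ← (measurePreserving_pi_swap I (Fin d)).lintegral_comp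
        (f := fun y : Fin d → I → ℝ => ∏ k, g k (y k)) (Finset.measurable_fun_prod _ fun k _ => (hg k).comp (measurable_pi_apply k))]
    have hof := volume_preserving_pi (f := fun _ : I => @WithLp.ofLp 2 (Fin d → ℝ))
      fun _ => PiLp.volume_preserving_ofLp (Fin d)
    rw [← hof.lintegral_comp (f := fun y : I → Fin d → ℝ => ∏ k, g k fun i => y i k)
      (Finset.measurable_fun_prod _ fun k _ => (hg k).comp (by fun_prop))]
  simp only [hfac]
  rw [hswap]
  simp only [g, G.lintegral_exp_neg_energy hc]
  have : Nonempty (Fin d) := ⟨⟨0, hd⟩⟩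
  split_ifs with h0
  -- Since `d > 0`, the product of `d` infinite factors is infinite and not an empty product.
  · simp [hd.ne']
  · have hpos : 0 < G.dualForestPoly (singletonPartition X I) c :=
      lt_of_le_of_ne (G.dualForestPoly_nonneg _ fun e => (hc e).le) (Ne.symm h0)
    rw [← ENNReal.ofReal_prod_of_nonneg fun _ _ => by positivity, Finset.prod_mul_distrib,
      ← Real.exp_sum, Finset.prod_const, mul_pow, Finset.card_univ, Fintype.card_fin]
    congr 2
    · congr 1
      · rw [Real.sqrt_eq_rpow, ← pow_mul, mul_comm, pow_mul, ← Real.rpow_mul_natCast Real.pi_nonneg]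
        congr 2
        ring
      · rw [Real.sqrt_eq_rpow, inv_pow, ← Real.rpow_mul_natCast hpos.le]
        congr 2
        ring
    · rw [Finset.sum_neg_distrib, ← Finset.sum_div, Finset.sum_comm]
      congr 3
      refine Finset.sum_congr rfl fun z _ => ?_
      rw [← Finset.sum_mul]
      congr 1
      induction z with
      | _ i j => simp [sqDist_mk]

end FeynmanGraph

/-! ### Gamma integrals and the Schwinger trick. -/

open Set

/-- A non-integrable function would have Bochner integral `0`, but the known value is positive. -/
theorem integrableOn_rpow_mul_exp_neg_mul {M r : ℝ} (hM : 0 < M) (hr : 0 < r) :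
    IntegrableOn (fun t : ℝ => t ^ (M - 1) * Real.exp (-(r * t))) (Ioi 0) := by
  by_contra h
  have h1 := Real.integral_rpow_mul_exp_neg_mul_Ioi hM hr
  rw [integral_undef h] at h1
  have : 0 < (1 / r) ^ M * Real.Gamma M := mul_pos (by positivity) (Real.Gamma_pos_of_pos hM)
  linarith

theorem rpow_mul_exp_neg_div_eq {M r x : ℝ} (hx : 0 < x) :
    x ^ (-M - 1) * Real.exp (-(r / x)) =
      (|(-1 : ℝ)| * x ^ ((-1 : ℝ) - 1)) •
        ((x ^ (-1 : ℝ)) ^ (M - 1) * Real.exp (-(r * x ^ (-1 : ℝ)))) := by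
  rw [abs_neg, abs_one, one_mul, smul_eq_mul, ← mul_assoc, ← Real.rpow_mul hx.le,
    ← Real.rpow_add hx, Real.rpow_neg_one, ← div_eq_mul_inv]
  congr 2
  ring

/-- The Gamma integral in the inverse variable. -/
theorem lintegral_rpow_mul_exp_neg_div {M r : ℝ} (hM : 0 < M) (hr : 0 < r) :
    ∫⁻ s in Ioi (0 : ℝ), ENNReal.ofReal (s ^ (-M - 1) * Real.exp (-(r / s))) =
      ENNReal.ofReal (Real.Gamma M / r ^ M) := by
  have hint : IntegrableOn (fun s : ℝ => s ^ (-M - 1) * Real.exp (-(r / s))) (Ioi 0) := by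
    refine ((integrableOn_Ioi_comp_rpow_iff (fun t : ℝ => t ^ (M - 1) * Real.exp (-(r * t)))
      (by norm_num : (-1 : ℝ) ≠ 0)).2 (integrableOn_rpow_mul_exp_neg_mul hM hr)).congr_fun
      (fun x hx => ?_) measurableSet_Ioi
    exact (rpow_mul_exp_neg_div_eq hx).symm
  rw [← ofReal_integral_eq_lintegral_ofReal hint
    ((ae_restrict_iff' measurableSet_Ioi).2 (.of_forall fun s (hs : 0 < s) => by positivity)),
    setIntegral_congr_fun measurableSet_Ioi fun x hx => rpow_mul_exp_neg_div_eq hx,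
    integral_comp_rpow_Ioi (fun t : ℝ => t ^ (M - 1) * Real.exp (-(r * t)))
      (by norm_num : (-1 : ℝ) ≠ 0), Real.integral_rpow_mul_exp_neg_mul_Ioi hM hr,
    Real.div_rpow zero_le_one hr.le, Real.one_rpow]
  congr 1
  ring

/-- For `M ≤ 0` the tail dominates a non-integrable power; for `r = 0` a pure power is never
integrable on the half-line. These divergences later yield `M > 0` and `Φ > 0`. -/
theorem lintegral_rpow_mul_exp_neg_div_eq_top {M r : ℝ} (hr : 0 ≤ r) (h : M ≤ 0 ∨ r = 0) :
    ∫⁻ s in Ioi (0 : ℝ), ENNReal.ofReal (s ^ (-M - 1) * Real.exp (-(r / s))) = ∞ := by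
  by_contra hne
  have hint : IntegrableOn (fun s : ℝ => s ^ (-M - 1) * Real.exp (-(r / s))) (Ioi 0) := by
    refine (lintegral_ofReal_ne_top_iff_integrable ?_ ?_).1 hne
    · exact Measurable.aestronglyMeasurable (by fun_prop)
    · exact (ae_restrict_iff' measurableSet_Ioi).2 (.of_forall fun s (hs : 0 < s) => by positivity)
  rcases h with hM | rfl
  · have h1 : IntegrableOn (fun s : ℝ => s ^ (-M - 1)) (Ioi 1) := by
      refine ((hint.mono_set (Ioi_subset_Ioi zero_le_one)).const_mul (Real.exp r)).mono'
        (Measurable.aestronglyMeasurable (by fun_prop))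
        ((ae_restrict_iff' measurableSet_Ioi).2 (.of_forall fun s (hs : 1 < s) => ?_))
      have hs0 : 0 < s := one_pos.trans hs
      rw [Real.norm_of_nonneg (by positivity), mul_left_comm, ← Real.exp_add]
      refine le_mul_of_one_le_right (by positivity) (Real.one_le_exp ?_)
      have : r / s ≤ r := div_le_self hr hs.le
      linarith
    rw [integrableOn_Ioi_rpow_iff one_pos] at h1
    linarith
  · exact not_integrableOn_Ioi_rpow (-M - 1) (by simpa using hint)

/-- The Schwinger parametrization of a propagator. -/
theorem ofReal_Gamma_mul_inv_rpow {Q s : ℝ} (hQ : 0 ≤ Q) (hs : 0 < s) :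
    ENNReal.ofReal (Real.Gamma s) * (ENNReal.ofReal Q ^ s)⁻¹ =
      ∫⁻ a in Ioi (0 : ℝ), ENNReal.ofReal (a ^ (-s - 1) * Real.exp (-(Q / a))) := by
  rcases hQ.eq_or_lt with rfl | hQ
  -- At `Q = 0` both sides are infinite, so coinciding points need no exclusion.
  · rw [lintegral_rpow_mul_exp_neg_div_eq_top le_rfl (Or.inr rfl), ENNReal.ofReal_zero,
      ENNReal.zero_rpow_of_pos hs, ENNReal.inv_zero, ENNReal.mul_top]
    simpa using Real.Gamma_pos_of_pos hs
  · rw [lintegral_rpow_mul_exp_neg_div hs hQ, ENNReal.ofReal_rpow_of_pos hQ,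
      ← ENNReal.ofReal_inv_of_pos (by positivity), ← ENNReal.ofReal_mul
      (Real.Gamma_pos_of_pos hs).le, div_eq_mul_inv]

/-- The open positive orthant. -/
def positiveOrthant (E : Type*) : Set (E → ℝ) := {α | ∀ e, 0 < α e}

theorem positiveOrthant_eq_pi (E : Type*) : positiveOrthant E = univ.pi fun _ => Ioi 0 := by
  ext; simp [positiveOrthant]

theorem measurableSet_positiveOrthant (E : Type*) [Finite E] :
    MeasurableSet (positiveOrthant E) := by
  rw [positiveOrthant_eq_pi]
  exact MeasurableSet.univ_pi fun _ => measurableSet_Ioi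

theorem volume_positiveOrthant_ne_zero (E : Type*) [Fintype E] :
    volume (positiveOrthant E) ≠ 0 := by
  rw [positiveOrthant_eq_pi, volume_pi_pi]
  simp

theorem prod_ofReal_Gamma_mul_inv_prod_rpow {E : Type*} [Fintype E] {Q s : E → ℝ}
    (hQ : ∀ e, 0 ≤ Q e) (hs : ∀ e, 0 < s e) :
    (∏ e, ENNReal.ofReal (Real.Gamma (s e))) * (∏ e, ENNReal.ofReal (Q e) ^ s e)⁻¹ =
      ∫⁻ α in positiveOrthant E, ENNReal.ofReal (∏ e, α e ^ (-s e - 1)) *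
        ENNReal.ofReal (Real.exp (-∑ e, (α e)⁻¹ * Q e)) := by
  -- Inversion is multiplicative here because no factor is infinite, which rules out `0 * ∞`.
  have h1 : (∏ e, ENNReal.ofReal (Q e) ^ s e)⁻¹ = ∏ e, (ENNReal.ofReal (Q e) ^ s e)⁻¹ := by
    refine ENNReal.prod_inv_distrib fun i _ j _ _ => Or.inr ?_
    exact ENNReal.rpow_ne_top_of_nonneg (hs j).le ENNReal.ofReal_ne_top
  rw [h1, ← Finset.prod_mul_distrib,
    Finset.prod_congr rfl fun e _ => ofReal_Gamma_mul_inv_rpow (hQ e) (hs e),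
    ← lintegral_prod_eval_eq_prod (fun _ : E => volume.restrict (Ioi (0 : ℝ)))
      (fun e a => ENNReal.ofReal (a ^ (-s e - 1) * Real.exp (-(Q e / a)))) fun e => by fun_prop,
    ← Measure.restrict_pi_pi, ← positiveOrthant_eq_pi, ← volume_pi]
  refine setLIntegral_congr_fun (measurableSet_positiveOrthant E) fun α hα => ?_
  have hα' : ∀ e, 0 < α e := hα
  rw [← ENNReal.ofReal_prod_of_nonneg fun e _ => by have := hα' e; positivity,
    Finset.prod_mul_distrib, ← Real.exp_sum, ENNReal.ofReal_mul
      (Finset.prod_nonneg fun e _ => by have := hα' e; positivity), Finset.sum_neg_distrib]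
  simp only [div_eq_inv_mul]

/-! ### Homogeneous coordinates on the positive orthant. -/

/-- Splitting off one coordinate. -/
def insertCoord {E : Type*} [DecidableEq E] (e₀ : E) (q : ℝ × ({e : E // e ≠ e₀} → ℝ)) : E → ℝ :=
  fun e => if h : e = e₀ then q.1 else q.2 ⟨e, h⟩

section

variable {E : Type*} [DecidableEq E] (e₀ : E)

theorem measurable_insertCoord : Measurable (insertCoord e₀) := by
  refine measurable_pi_lambda _ fun e => ?_
  by_cases h : e = e₀
  · simp only [insertCoord, h, dif_pos]
    exact measurable_fst
  · simp only [insertCoord, h, dif_neg, not_false_iff]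
    fun_prop

theorem insertCoord_smul (s : ℝ) (β : {e : E // e ≠ e₀} → ℝ) :
    insertCoord e₀ (s, s • β) = fun e => s * affineChart e₀ β e := by
  ext e
  by_cases h : e = e₀ <;> simp [insertCoord, affineChart, h]

theorem insertCoord_mem_positiveOrthant (s : ℝ) (β : {e : E // e ≠ e₀} → ℝ) :
    insertCoord e₀ (s, β) ∈ positiveOrthant E ↔ 0 < s ∧ β ∈ positiveOrthant _ := by
  constructor
  · intro h
    refine ⟨by simpa [insertCoord] using h e₀, fun e => ?_⟩
    simpa [insertCoord, e.2] using h e.1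
  · rintro ⟨h1, h2⟩ e
    by_cases h : e = e₀
    · simpa [insertCoord, h] using h1
    · simpa [insertCoord, h] using h2 ⟨e, h⟩

theorem affineChart_pos {β : {e : E // e ≠ e₀} → ℝ} (hβ : β ∈ positiveOrthant _) (e : E) :
    0 < affineChart e₀ β e :=
  (insertCoord_mem_positiveOrthant e₀ 1 β).2 ⟨one_pos, hβ⟩ e

variable [Fintype E]

theorem measurePreserving_insertCoord : MeasurePreserving (insertCoord e₀) := by
  refine ⟨measurable_insertCoord e₀, (Measure.pi_eq fun s hs => ?_).symm⟩
  rw [Measure.map_apply (measurable_insertCoord e₀) (MeasurableSet.univ_pi hs)]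
  have hpre : insertCoord e₀ ⁻¹' univ.pi s =
      s e₀ ×ˢ univ.pi fun e : {e : E // e ≠ e₀} => s e := by
    ext ⟨a, β⟩
    simp only [mem_preimage, mem_pi, mem_univ, true_imp_iff, mem_prod]
    constructor
    · intro h
      refine ⟨by simpa [insertCoord] using h e₀, fun e => ?_⟩
      simpa [insertCoord, e.2] using h e.1
    · rintro ⟨h1, h2⟩ e
      by_cases h : e = e₀
      · subst h; simpa [insertCoord] using h1
      · simpa [insertCoord, h] using h2 ⟨e, h⟩
  rw [hpre, Measure.volume_eq_prod, Measure.prod_prod, volume_pi_pi,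
    Fintype.prod_eq_mul_prod_subtype_ne _ e₀]

/-- Integration over the positive orthant in homogeneous coordinates. -/
theorem setLIntegral_positiveOrthant_eq {f : (E → ℝ) → ℝ≥0∞} (hf : Measurable f) :
    ∫⁻ α in positiveOrthant E, f α =
      ∫⁻ β in positiveOrthant {e : E // e ≠ e₀}, ∫⁻ s in Ioi (0 : ℝ),
        ENNReal.ofReal (s ^ (Fintype.card E - 1)) * f (fun e => s * affineChart e₀ β e) := by
  have hcard : Fintype.card {e : E // e ≠ e₀} = Fintype.card E - 1 := by
    simp [Fintype.card_subtype_compl]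
  have hO := measurableSet_positiveOrthant {e : E // e ≠ e₀}
  have hind : ∀ (s : ℝ) (β : {e : E // e ≠ e₀} → ℝ),
      (positiveOrthant E).indicator f (insertCoord e₀ (s, β)) =
        (Ioi (0 : ℝ)).indicator (fun s => (positiveOrthant {e : E // e ≠ e₀}).indicator
          (fun β => f (insertCoord e₀ (s, β))) β) s := by
    intro s β
    by_cases h : insertCoord e₀ (s, β) ∈ positiveOrthant E
    · obtain ⟨h1, h2⟩ := (insertCoord_mem_positiveOrthant e₀ s β).1 h
      rw [indicator_of_mem h, indicator_of_mem (show s ∈ Ioi 0 from h1), indicator_of_mem h2]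
    · rw [indicator_of_notMem h]
      by_cases h1 : s ∈ Ioi (0 : ℝ)
      · rw [indicator_of_mem h1, indicator_of_notMem fun h2 =>
          h ((insertCoord_mem_positiveOrthant e₀ s β).2 ⟨h1, h2⟩)]
      · rw [indicator_of_notMem h1]
  rw [← lintegral_indicator (measurableSet_positiveOrthant E),
    ← (measurePreserving_insertCoord e₀).lintegral_comp
      (hf.indicator (measurableSet_positiveOrthant E)), Measure.volume_eq_prod,
    lintegral_prod (fun q => (positiveOrthant E).indicator f (insertCoord e₀ q))
      ((hf.indicator (measurableSet_positiveOrthant E)).comp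
        (measurable_insertCoord e₀)).aemeasurable]
  have hstep : ∀ s : ℝ, ∫⁻ β, (positiveOrthant E).indicator f (insertCoord e₀ (s, β)) =
      (Ioi (0 : ℝ)).indicator (fun s => ∫⁻ β in positiveOrthant {e : E // e ≠ e₀},
        ENNReal.ofReal (s ^ (Fintype.card E - 1)) * f (fun e => s * affineChart e₀ β e)) s := by
    intro s
    simp only [hind]
    by_cases hs : s ∈ Ioi (0 : ℝ)
    · have hs' : 0 < s := hs
      simp only [indicator_of_mem hs]
      have hm1 : Measurable fun β : {e : E // e ≠ e₀} → ℝ => f (insertCoord e₀ (s, β)) :=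
        hf.comp ((measurable_insertCoord e₀).comp measurable_prodMk_left)
      -- Rescaling the `|E| - 1` remaining coordinates by `s` produces the Jacobian `s ^ (|E| - 1)`.
      have hmap := Measure.map_addHaar_smul
        (volume : Measure ({e : E // e ≠ e₀} → ℝ)) hs'.ne'
      have h2 := lintegral_map (μ := (volume : Measure ({e : E // e ≠ e₀} → ℝ)))
        (hm1.indicator hO) (measurable_const_smul s)
      rw [hmap, lintegral_smul_measure, Module.finrank_fintype_fun_eq_card, hcard,
        abs_of_pos (by positivity), smul_eq_mul] at h2
      have h3 : ∀ β : {e : E // e ≠ e₀} → ℝ,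
          (positiveOrthant {e : E // e ≠ e₀}).indicator
            (fun β => f (insertCoord e₀ (s, β))) (s • β) =
          (positiveOrthant {e : E // e ≠ e₀}).indicator
            (fun β => f (fun e => s * affineChart e₀ β e)) β := by
        intro β
        have hiff : s • β ∈ positiveOrthant {e : E // e ≠ e₀} ↔ β ∈ positiveOrthant _ := by
          simp [positiveOrthant, hs']
        by_cases hβ : β ∈ positiveOrthant {e : E // e ≠ e₀}
        · rw [indicator_of_mem hβ, indicator_of_mem (hiff.2 hβ), insertCoord_smul]
        · rw [indicator_of_notMem hβ, indicator_of_notMem (mt hiff.1 hβ)]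
      simp only [h3] at h2
      rw [lintegral_const_mul' _ _ ENNReal.ofReal_ne_top, ← lintegral_indicator hO, ← h2,
        ← mul_assoc, ← ENNReal.ofReal_mul (by positivity),
        mul_inv_cancel₀ (by positivity), ENNReal.ofReal_one, one_mul]
    · simp [indicator_of_notMem hs]
  simp only [hstep]
  rw [lintegral_indicator measurableSet_Ioi, lintegral_lintegral_swap]
  refine Measurable.aemeasurable ?_
  have hc : Measurable fun q : ℝ × ({e : E // e ≠ e₀} → ℝ) =>
      fun e => q.1 * affineChart e₀ q.2 e := by
    refine measurable_pi_lambda _ fun e => measurable_fst.mul ?_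
    exact (measurable_pi_apply e).comp ((measurable_insertCoord e₀).comp
      (measurable_prodMk_left.comp measurable_snd : Measurable fun q : ℝ ×
        ({e : E // e ≠ e₀} → ℝ) => ((1 : ℝ), q.2)))
  exact (ENNReal.measurable_ofReal.comp (measurable_fst.pow_const _)).mul (hf.comp hc)

end

/-! ### Homogeneity of the forest polynomials and of the parametric integrand. -/

namespace FeynmanGraph

variable {X I E : Type*} (G : FeynmanGraph X I E)

theorem lam_pos {d : ℕ} (hd : 2 < d) : 0 < lam d := by
  have : (2 : ℝ) < d := by exact_mod_cast hd
  rw [lam]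
  linarith

theorem sqDist_nonneg {A : Type*} {d : ℕ} (x : A → EuclideanSpace ℝ (Fin d)) (z : Sym2 A) :
    0 ≤ sqDist x z := by
  induction z with
  | _ u v => simp [sqDist]

section ForestPolynomials

variable [Fintype E] [DecidableEq E]

theorem forestPoly_eq_prod_mul_dualForestPoly (p : Set (Set (X ⊕ I))) (α : E → ℝ)
    (hα : ∀ e, α e ≠ 0) :
    G.forestPoly p α = (∏ e, α e) * G.dualForestPoly p (fun e => (α e)⁻¹) := by
  rw [forestPoly, dualForestPoly, Finset.mul_sum]
  refine Finset.sum_congr rfl fun F _ => ?_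
  rw [← Finset.prod_mul_prod_compl F α, mul_right_comm, ← Finset.prod_mul_distrib,
    Finset.prod_congr rfl fun e _ => mul_inv_cancel₀ (hα e)]
  simp

theorem forestPoly_nonneg (p : Set (Set (X ⊕ I))) {α : E → ℝ} (hα : ∀ e, 0 < α e) :
    0 ≤ G.forestPoly p α :=
  Finset.sum_nonneg fun _ _ => Finset.prod_nonneg fun e _ => (hα e).le

theorem forestPoly_smul (p : Set (Set (X ⊕ I))) (m : ℕ)
    (hm : ∀ F, G.IsSpanningForest p F → F.card = m) {t : ℝ} (α : E → ℝ) :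
    G.forestPoly p (fun e => t * α e) =
      t ^ ((Fintype.card E : ℝ) - m) * G.forestPoly p α := by
  rw [forestPoly, forestPoly, Finset.mul_sum]
  refine Finset.sum_congr rfl fun F hF => ?_
  rw [Finset.prod_mul_distrib, Finset.prod_const, ← Real.rpow_natCast, Finset.card_compl,
    Nat.cast_sub (Finset.card_le_univ F), hm F (G.mem_spanningForests.1 hF)]

theorem continuous_forestPoly (p : Set (Set (X ⊕ I))) : Continuous (G.forestPoly p) := by
  unfold forestPoly
  fun_prop

variable [Fintype X] [Fintype I]

theorem psi_smul (t : ℝ) (α : E → ℝ) :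
    G.psi (fun e => t * α e) =
      t ^ ((Fintype.card E : ℝ) - Fintype.card I) * G.psi α :=
  G.forestPoly_smul _ _ (fun F hF => ((G.isSpanningForest_singletonPartition_iff F).1 hF).1) α

omit [Fintype X] [Fintype I] in
theorem psi_nonneg {α : E → ℝ} (hα : ∀ e, 0 < α e) : 0 ≤ G.psi α :=
  G.forestPoly_nonneg _ hα

variable [DecidableEq X]

/-- A forest for a pair has one edge more than one for the singletons, so `phi` has degree one less
than `psi` and their quotient has degree `-1`. -/
theorem phi_smul {d : ℕ} (x : X → EuclideanSpace ℝ (Fin d)) (t : ℝ) (α : E → ℝ) :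
    G.phi x (fun e => t * α e) =
      t ^ ((Fintype.card E : ℝ) - (Fintype.card I + 1 : ℕ)) * G.phi x α := by
  rw [phi, phi, Finset.mul_sum]
  refine Finset.sum_congr rfl fun z hz => ?_
  rw [Finset.mem_filter] at hz
  rw [mul_left_comm]
  congr 1
  refine G.forestPoly_smul _ _ (fun F hF => ?_) α
  induction z with
  | _ i j => exact ((G.isSpanningForest_pairPartition_iff (by simpa using hz.2) F).1 hF).1

omit [Fintype I] in
theorem phi_nonneg {d : ℕ} (x : X → EuclideanSpace ℝ (Fin d)) {α : E → ℝ} (hα : ∀ e, 0 < α e) :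
    0 ≤ G.phi x α :=
  Finset.sum_nonneg fun z _ => mul_nonneg (sqDist_nonneg x z) (G.forestPoly_nonneg _ hα)

omit [Fintype I] in
theorem continuous_phi {d : ℕ} (x : X → EuclideanSpace ℝ (Fin d)) :
    Continuous (G.phi (I := I) x) := by
  unfold phi
  exact continuous_finsetSum _ fun z _ => continuous_const.mul (G.continuous_forestPoly _)

omit [DecidableEq E] [Fintype X] [Fintype I] [DecidableEq X] in
theorem prod_mul_rpow {t : ℝ} (ht : 0 < t) {α : E → ℝ} (hα : ∀ e, 0 < α e) (a : E → ℝ) :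
    ∏ e, (t * α e) ^ a e = t ^ (∑ e, a e) * ∏ e, α e ^ a e := by
  rw [Finset.prod_congr rfl fun e _ => Real.mul_rpow ht.le (hα e).le, Finset.prod_mul_distrib,
    Real.rpow_sum_of_pos ht]

omit [DecidableEq E] [Fintype X] [DecidableEq X] in
theorem sum_exponents (d : ℕ) :
    ∑ e, ((d : ℝ) / 2 - lam d * G.weight e - 1) =
      (d : ℝ) / 2 * (Fintype.card E - Fintype.card I) - G.superficialDegree d -
        Fintype.card E := by
  simp only [superficialDegree, Finset.sum_sub_distrib, Finset.sum_const, Finset.card_univ,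
    nsmul_eq_mul, ← Finset.mul_sum]
  ring

/-- The denominator has degree `(|E| - |I| - 1) M + (|E| - |I|) (d/2 - M) = (|E| - |I|) d/2 - M`,
which exceeds the degree of the numerator by `|E|`. -/
theorem isProjectiveDensity_parametricIntegrand {d : ℕ} (x : X → EuclideanSpace ℝ (Fin d)) :
    IsProjectiveDensity (G.parametricIntegrand x) := by
  intro t α ht hα
  have h1 : 0 < t ^ ((Fintype.card E : ℝ) - (Fintype.card I + 1 : ℕ)) := Real.rpow_pos_of_pos ht _
  have h2 : 0 < t ^ ((Fintype.card E : ℝ) - Fintype.card I) := Real.rpow_pos_of_pos ht _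
  rw [parametricIntegrand, parametricIntegrand, prod_mul_rpow ht hα, phi_smul, psi_smul,
    Real.mul_rpow h1.le (G.phi_nonneg x hα), Real.mul_rpow h2.le (G.psi_nonneg hα),
    mul_mul_mul_comm, mul_div_mul_comm, ← Real.rpow_mul ht.le, ← Real.rpow_mul ht.le,
    ← Real.rpow_add ht, ← Real.rpow_sub ht, sum_exponents, ← Real.rpow_natCast,
    ← Real.rpow_neg ht.le]
  congr 2
  push_cast
  ring

end ForestPolynomials

/-! ### From the position integral to the projective integral. -/

section Analysis

variable [Fintype X] [DecidableEq X] [Fintype I] [Fintype E] [DecidableEq E]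

omit [DecidableEq X] [DecidableEq E] [Fintype X] in
theorem prod_Gamma_mul_positionIntegral {d : ℕ} (hd : 2 < d) (hpos : ∀ e, 0 < G.weight e)
    (x : X → EuclideanSpace ℝ (Fin d)) :
    (∏ e, ENNReal.ofReal (Real.Gamma (lam d * G.weight e))) * G.positionIntegral d x =
      ENNReal.ofReal ((1 / Real.pi ^ ((d : ℝ) / 2)) ^ Fintype.card I) *
        ∫⁻ α in positiveOrthant E, ENNReal.ofReal (∏ e, α e ^ (-(lam d * G.weight e) - 1)) *
          ∫⁻ w : I → EuclideanSpace ℝ (Fin d), ENNReal.ofReal (Real.exp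
            (-∑ e, (α e)⁻¹ * sqDist (Sum.elim x w) (G.ends e))) := by
  have hs : ∀ e, 0 < lam d * G.weight e := fun e => mul_pos (lam_pos hd) (hpos e)
  have hne : (∏ e, ENNReal.ofReal (Real.Gamma (lam d * G.weight e))) ≠ ∞ :=
    ENNReal.prod_ne_top fun e _ => ENNReal.ofReal_ne_top
  have helim : ∀ u : X ⊕ I, Measurable fun w : I → EuclideanSpace ℝ (Fin d) =>
      Sum.elim x w u := by
    rintro (u | u)
    · exact measurable_const
    · exact measurable_pi_apply u
  have hsq : ∀ e, Measurable fun w : I → EuclideanSpace ℝ (Fin d) =>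
      sqDist (Sum.elim x w) (G.ends e) := by
    intro e
    simp only [G.ends_eq e, sqDist, Sym2.lift_mk]
    exact ((helim _).sub (helim _)).norm.pow_const 2
  have hexp : Measurable fun q : (I → EuclideanSpace ℝ (Fin d)) × (E → ℝ) =>
      ENNReal.ofReal (Real.exp (-∑ e, (q.2 e)⁻¹ * sqDist (Sum.elim x q.1) (G.ends e))) := by
    refine ENNReal.measurable_ofReal.comp (Real.measurable_exp.comp (Measurable.neg ?_))
    refine Finset.measurable_fun_sum _ fun e _ => Measurable.mul ?_ ((hsq e).comp measurable_fst)
    fun_prop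
  rw [positionIntegral, mul_left_comm, ← lintegral_const_mul' _ _ hne]
  congr 1
  simp only [positionIntegrand]
  rw [lintegral_congr fun w => prod_ofReal_Gamma_mul_inv_prod_rpow
    (fun e => sqDist_nonneg (Sum.elim x w) (G.ends e)) hs, lintegral_lintegral_swap]
  · refine lintegral_congr fun α => ?_
    rw [lintegral_const_mul' _ _ ENNReal.ofReal_ne_top]
  · refine (Measurable.mul ?_ hexp).aemeasurable
    fun_prop

/-- The power factor of the integrand of the Schwinger representation. -/
noncomputable def schwingerFactor (d : ℕ) (α : E → ℝ) : ℝ :=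
  (∏ e, α e ^ ((d : ℝ) / 2 - lam d * G.weight e - 1)) * (G.psi α ^ ((d : ℝ) / 2))⁻¹

omit [Fintype X] [Fintype I] [DecidableEq X] in
theorem measurable_schwingerFactor (d : ℕ) : Measurable (G.schwingerFactor d) := by
  have := (G.continuous_forestPoly (singletonPartition X I)).measurable
  unfold schwingerFactor psi
  fun_prop

/-- In terms of `α` the conductances are `1 / α e`, so each dual polynomial loses a factor `∏ α e`.
These factors cancel in `Φ / Ψ`, while the power `Ψ ^ (-d/2)` contributes `d/2` to every exponent.
-/
theorem internal_integral_eq {d : ℕ} (hd : 2 < d) (x : X → EuclideanSpace ℝ (Fin d)) {α : E → ℝ}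
    (hα : ∀ e, 0 < α e) :
    ENNReal.ofReal (∏ e, α e ^ (-(lam d * G.weight e) - 1)) *
      ∫⁻ w : I → EuclideanSpace ℝ (Fin d), ENNReal.ofReal (Real.exp
        (-∑ e, (α e)⁻¹ * sqDist (Sum.elim x w) (G.ends e))) =
      if G.psi α = 0 then ∞ else
        ENNReal.ofReal ((Real.pi ^ ((d : ℝ) / 2)) ^ Fintype.card I) *
          ENNReal.ofReal (G.schwingerFactor d α * Real.exp (-(G.phi x α / G.psi α))) := by
  classical
  have hα' : ∀ e, 0 < (α e)⁻¹ := fun e => inv_pos.2 (hα e)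
  have hprod : 0 < ∏ e, α e := Finset.prod_pos fun e _ => hα e
  have hfp : ∀ p, G.forestPoly p α = (∏ e, α e) * G.dualForestPoly p (fun e => (α e)⁻¹) :=
    fun p => G.forestPoly_eq_prod_mul_dualForestPoly p α fun e => (hα e).ne'
  have hpsi : G.psi α = 0 ↔
      G.dualForestPoly (singletonPartition X I) (fun e => (α e)⁻¹) = 0 := by
    rw [psi, hfp, mul_eq_zero, or_iff_right hprod.ne']
  have hphi : G.phi x α = (∏ e, α e) * ∑ z : Sym2 X with ¬ z.IsDiag,
      sqDist x z * G.dualForestPoly (pairPartition I z) (fun e => (α e)⁻¹) := by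
    rw [phi, Finset.mul_sum]
    exact Finset.sum_congr rfl fun z _ => by rw [hfp, mul_left_comm]
  have hpw : ∀ e, 0 < α e ^ (-(lam d * G.weight e) - 1) := fun e => Real.rpow_pos_of_pos (hα e) _
  rw [G.lintegral_exp_neg_sqDist (by omega) hα' x]
  simp only [← hpsi]
  split_ifs with h0
  · refine ENNReal.mul_top ?_
    simpa using Finset.prod_pos fun e _ => hpw e
  · rw [← ENNReal.ofReal_mul (Finset.prod_nonneg fun e _ => (hpw e).le),
      ← ENNReal.ofReal_mul (by positivity)]
    congr 1
    have hΨ : 0 ≤ G.dualForestPoly (singletonPartition X I) (fun e => (α e)⁻¹) :=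
      G.dualForestPoly_nonneg _ fun e => (hα' e).le
    have h1 : ∏ e, α e ^ ((d : ℝ) / 2 - lam d * G.weight e - 1) =
        (∏ e, α e) ^ ((d : ℝ) / 2) * ∏ e, α e ^ (-(lam d * G.weight e) - 1) := by
      rw [← Real.finsetProd_rpow _ _ fun e _ => (hα e).le, ← Finset.prod_mul_distrib]
      refine Finset.prod_congr rfl fun e _ => ?_
      rw [← Real.rpow_add (hα e)]
      congr 1
      ring
    have h2 : (∏ e, α e) ^ ((d : ℝ) / 2) ≠ 0 := (Real.rpow_pos_of_pos hprod _).ne'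
    rw [schwingerFactor, h1, hphi, psi, hfp, mul_div_mul_left _ _ hprod.ne',
      Real.mul_rpow hprod.le hΨ, mul_inv]
    field_simp

omit [Fintype I] [DecidableEq X] [Fintype X] in
-- Positivity depends only on the existence of a spanning forest, not on the point.
theorem psi_pos_of_ne_zero {β : E → ℝ} (h : G.psi β ≠ 0) {α : E → ℝ} (hα : ∀ e, 0 < α e) :
    0 < G.psi α := by
  refine Finset.sum_pos (fun F _ => Finset.prod_pos fun e _ => hα e) ?_
  by_contra hne
  exact h (by rw [psi, forestPoly, Finset.not_nonempty_iff_eq_empty.1 hne, Finset.sum_empty])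

/-- Otherwise `psi` vanishes on the whole orthant, a set of positive measure on which the Gaussian
integral is then infinite. -/
theorem psi_pos_of_converges {d : ℕ} (hd : 2 < d) (hpos : ∀ e, 0 < G.weight e)
    {x : X → EuclideanSpace ℝ (Fin d)} (hconv : G.Converges d x) {α : E → ℝ}
    (hα : ∀ e, 0 < α e) : 0 < G.psi α := by
  by_contra hcon
  have h0 : ∀ β ∈ positiveOrthant E, G.psi β = 0 := by
    intro β _
    by_contra hβ
    exact hcon (G.psi_pos_of_ne_zero hβ hα)
  have h1 := G.prod_Gamma_mul_positionIntegral hd hpos x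
  rw [setLIntegral_congr_fun (g := fun _ => ∞) (measurableSet_positiveOrthant E) fun β hβ =>
      (G.internal_integral_eq hd x hβ).trans (if_pos (h0 β hβ)), setLIntegral_const,
    ENNReal.top_mul (volume_positiveOrthant_ne_zero E), ENNReal.mul_top (by
      simp only [ne_eq, ENNReal.ofReal_eq_zero, not_le]; positivity)] at h1
  refine ENNReal.mul_ne_top ?_ hconv.ne h1
  exact ENNReal.prod_ne_top fun e _ => ENNReal.ofReal_ne_top

/-- The Schwinger representation of a convergent Feynman integral. -/
theorem schwinger_representation {d : ℕ} (hd : 2 < d) (hpos : ∀ e, 0 < G.weight e)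
    {x : X → EuclideanSpace ℝ (Fin d)} (hconv : G.Converges d x) :
    (∏ e, ENNReal.ofReal (Real.Gamma (lam d * G.weight e))) * G.positionIntegral d x =
      ∫⁻ α in positiveOrthant E,
        ENNReal.ofReal (G.schwingerFactor d α * Real.exp (-(G.phi x α / G.psi α))) := by
  rw [G.prod_Gamma_mul_positionIntegral hd hpos x,
    setLIntegral_congr_fun (measurableSet_positiveOrthant E) fun β hβ =>
      (G.internal_integral_eq hd x hβ).trans
        (if_neg (G.psi_pos_of_converges hd hpos hconv hβ).ne'),
    lintegral_const_mul' _ _ ENNReal.ofReal_ne_top, ← mul_assoc,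
    ← ENNReal.ofReal_mul (by positivity), ← mul_pow, one_div,
    inv_mul_cancel₀ (by positivity), one_pow, ENNReal.ofReal_one, one_mul]

/-- The Schwinger representation in homogeneous coordinates. -/
theorem setLIntegral_schwinger_eq {d : ℕ} (x : X → EuclideanSpace ℝ (Fin d)) (e₀ : E)
    (hpsi : ∀ α : E → ℝ, (∀ e, 0 < α e) → 0 < G.psi α) :
    ∫⁻ α in positiveOrthant E,
        ENNReal.ofReal (G.schwingerFactor d α * Real.exp (-(G.phi x α / G.psi α))) =
      ∫⁻ β in positiveOrthant {e : E // e ≠ e₀},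
        ENNReal.ofReal (G.schwingerFactor d (affineChart e₀ β)) *
          ∫⁻ s in Ioi (0 : ℝ), ENNReal.ofReal (s ^ (-G.superficialDegree d - 1) *
            Real.exp (-(G.phi x (affineChart e₀ β) / G.psi (affineChart e₀ β) / s))) := by
  have hmeas : Measurable fun α : E → ℝ =>
      ENNReal.ofReal (G.schwingerFactor d α * Real.exp (-(G.phi x α / G.psi α))) := by
    have h1 := G.measurable_schwingerFactor d
    have h2 := (G.continuous_phi x).measurable
    have h3 : Measurable (G.psi) := (G.continuous_forestPoly (singletonPartition X I)).measurable
    fun_prop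
  rw [setLIntegral_positiveOrthant_eq e₀ hmeas]
  refine setLIntegral_congr_fun (measurableSet_positiveOrthant _) fun β hβ => ?_
  have hγ : ∀ e, 0 < affineChart e₀ β e := affineChart_pos e₀ hβ
  generalize affineChart e₀ β = γ at hγ
  have hψ := hpsi γ hγ
  have hP : 0 ≤ G.schwingerFactor d γ :=
    mul_nonneg (Finset.prod_nonneg fun e _ => (Real.rpow_pos_of_pos (hγ e) _).le) (by positivity)
  rw [← lintegral_const_mul' _ _ ENNReal.ofReal_ne_top]
  refine setLIntegral_congr_fun measurableSet_Ioi fun s (hs : 0 < s) => ?_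
  have hE : 1 ≤ Fintype.card E := Fintype.card_pos_iff.2 ⟨e₀⟩
  have h2 : 0 < s ^ ((Fintype.card E : ℝ) - Fintype.card I) := Real.rpow_pos_of_pos hs _
  rw [← ENNReal.ofReal_mul (by positivity), ← ENNReal.ofReal_mul hP]
  congr 1
  rw [← mul_assoc, ← mul_assoc, phi_smul, psi_smul]
  have hquot : s ^ ((Fintype.card E : ℝ) - (Fintype.card I + 1 : ℕ)) * G.phi x γ /
      (s ^ ((Fintype.card E : ℝ) - Fintype.card I) * G.psi γ) = G.phi x γ / G.psi γ / s := by
    rw [mul_div_mul_comm, ← Real.rpow_sub hs,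
      show (Fintype.card E : ℝ) - (Fintype.card I + 1 : ℕ) - (Fintype.card E - Fintype.card I) =
        -1 by push_cast; ring, Real.rpow_neg_one]
    field_simp
  -- Jacobian, monomial and `psi ^ (-d/2)` contribute `|E| - 1`, `d/2 (|E| - |I|) - M - |E|` and
  -- `-d/2 (|E| - |I|)`, with sum `-M - 1`.
  have hfac : s ^ (Fintype.card E - 1) * G.schwingerFactor d (fun e => s * γ e) =
      G.schwingerFactor d γ * s ^ (-G.superficialDegree d - 1) := by
    rw [schwingerFactor, schwingerFactor, prod_mul_rpow hs hγ, psi_smul,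
      Real.mul_rpow h2.le hψ.le, mul_inv, sum_exponents, ← Real.rpow_natCast,
      ← Real.rpow_mul hs.le, ← Real.rpow_neg hs.le, Nat.cast_sub hE]
    have : s ^ (-G.superficialDegree d - 1) =
        s ^ ((Fintype.card E : ℝ) - (1 : ℕ)) * s ^ ((d : ℝ) / 2 *
          (Fintype.card E - Fintype.card I) - G.superficialDegree d - Fintype.card E) *
        s ^ (-(((Fintype.card E : ℝ) - Fintype.card I) * ((d : ℝ) / 2))) := by
      rw [← Real.rpow_add hs, ← Real.rpow_add hs]
      congr 1
      push_cast
      ring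
    rw [this]
    ring
  rw [hquot, hfac]

theorem measurable_parametricIntegrand {d : ℕ} (x : X → EuclideanSpace ℝ (Fin d)) :
    Measurable (G.parametricIntegrand x) := by
  have h2 := (G.continuous_phi x).measurable
  have h3 : Measurable (G.psi) := (G.continuous_forestPoly (singletonPartition X I)).measurable
  unfold parametricIntegrand
  fun_prop

theorem schwingerFactor_mul_Gamma_div {d : ℕ} (x : X → EuclideanSpace ℝ (Fin d)) {γ : E → ℝ}
    (hψ : 0 < G.psi γ) (hφ : 0 < G.phi x γ) :
    G.schwingerFactor d γ * (Real.Gamma (G.superficialDegree d) /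
        (G.phi x γ / G.psi γ) ^ G.superficialDegree d) =
      Real.Gamma (G.superficialDegree d) * G.parametricIntegrand x γ := by
  have h1 : G.psi γ ^ G.superficialDegree d ≠ 0 := (Real.rpow_pos_of_pos hψ _).ne'
  have h2 : G.phi x γ ^ G.superficialDegree d ≠ 0 := (Real.rpow_pos_of_pos hφ _).ne'
  have h3 : G.psi γ ^ ((d : ℝ) / 2) ≠ 0 := (Real.rpow_pos_of_pos hψ _).ne'
  rw [schwingerFactor, parametricIntegrand, Real.div_rpow hφ.le hψ.le, Real.rpow_sub hψ]
  field_simp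

/-- The projective representation, as an identity in `[0, ∞]`. -/
theorem projective_representation {d : ℕ} (hd : 2 < d) (hpos : ∀ e, 0 < G.weight e)
    {x : X → EuclideanSpace ℝ (Fin d)} (hconv : G.Converges d x) (e₀ : E) :
    0 < G.superficialDegree d ∧
      (∏ e, ENNReal.ofReal (Real.Gamma (lam d * G.weight e))) * G.positionIntegral d x =
        ENNReal.ofReal (Real.Gamma (G.superficialDegree d)) *
          ∫⁻ β in positiveOrthant {e : E // e ≠ e₀},
            ENNReal.ofReal (G.parametricIntegrand x (affineChart e₀ β)) := by
  have hpsi : ∀ α : E → ℝ, (∀ e, 0 < α e) → 0 < G.psi α := fun α hα =>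
    G.psi_pos_of_converges hd hpos hconv hα
  have hrep := (G.schwinger_representation hd hpos hconv).trans
    (G.setLIntegral_schwinger_eq x e₀ hpsi)
  have hfin : (∏ e, ENNReal.ofReal (Real.Gamma (lam d * G.weight e))) *
      G.positionIntegral d x ≠ ∞ :=
    ENNReal.mul_ne_top (ENNReal.prod_ne_top fun e _ => ENNReal.ofReal_ne_top) hconv.ne
  have hO := measurableSet_positiveOrthant {e : E // e ≠ e₀}
  have hchart : Measurable (affineChart e₀) :=
    (measurable_insertCoord e₀).comp measurable_prodMk_left
  have hm : Measurable fun β : {e : E // e ≠ e₀} → ℝ =>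
      ENNReal.ofReal (G.schwingerFactor d (affineChart e₀ β)) *
        ∫⁻ s in Ioi (0 : ℝ), ENNReal.ofReal (s ^ (-G.superficialDegree d - 1) *
          Real.exp (-(G.phi x (affineChart e₀ β) / G.psi (affineChart e₀ β) / s))) := by
    have h1 := (G.measurable_schwingerFactor d).comp hchart
    have h2 := (G.continuous_phi x).measurable.comp hchart
    have h3 : Measurable fun β => G.psi (affineChart e₀ β) :=
      (G.continuous_forestPoly (singletonPartition X I)).measurable.comp hchart
    simp only [Function.comp_def] at h1 h2
    refine (ENNReal.measurable_ofReal.comp h1).mul (Measurable.lintegral_prod_right' (f := fun q :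
      ({e : E // e ≠ e₀} → ℝ) × ℝ => ENNReal.ofReal (q.2 ^ (-G.superficialDegree d - 1) *
          Real.exp (-(G.phi x (affineChart e₀ q.1) / G.psi (affineChart e₀ q.1) / q.2)))) ?_)
    have h2' := h2.comp (measurable_fst : Measurable fun q : ({e : E // e ≠ e₀} → ℝ) × ℝ => q.1)
    have h3' := h3.comp (measurable_fst : Measurable fun q : ({e : E // e ≠ e₀} → ℝ) × ℝ => q.1)
    simp only [Function.comp_def] at h2' h3'
    fun_prop
  -- The total integral is finite, so almost every ray integral, taken with its positive prefactor,
  -- is finite too; this excludes `M ≤ 0` and `Φ = 0`.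
  have hae : ∀ᵐ β ∂volume.restrict (positiveOrthant {e : E // e ≠ e₀}),
      0 < G.superficialDegree d ∧ 0 < G.phi x (affineChart e₀ β) := by
    have h1 := ae_lt_top hm (hrep ▸ hfin)
    filter_upwards [h1, ae_restrict_mem hO] with β hβ hβO
    have hγ : ∀ e, 0 < affineChart e₀ β e := affineChart_pos e₀ hβO
    have hψ := hpsi _ hγ
    have hφ := G.phi_nonneg x hγ
    have hP : 0 < G.schwingerFactor d (affineChart e₀ β) :=
      mul_pos (Finset.prod_pos fun e _ => Real.rpow_pos_of_pos (hγ e) _) (by positivity)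
    by_contra hcon
    rw [lintegral_rpow_mul_exp_neg_div_eq_top (div_nonneg hφ hψ.le), ENNReal.mul_top] at hβ
    · exact hβ.ne rfl
    · simpa using hP
    · by_contra h
      push Not at h
      refine hcon ⟨h.1, lt_of_le_of_ne hφ fun h0 => h.2 ?_⟩
      rw [← h0, zero_div]
  -- `M` does not depend on `β`, so one good point suffices; the orthant has positive measure even
  -- when `e₀` is the only edge and the chart is a point.
  have hM : 0 < G.superficialDegree d := by
    have hne : Filter.NeBot (ae (volume.restrict (positiveOrthant {e : E // e ≠ e₀}))) :=
      ae_restrict_neBot.2 (volume_positiveOrthant_ne_zero _)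
    obtain ⟨β, hβ⟩ := hae.exists
    exact hβ.1
  refine ⟨hM, hrep.trans ?_⟩
  rw [← lintegral_const_mul' _ _ ENNReal.ofReal_ne_top]
  refine lintegral_congr_ae ?_
  filter_upwards [hae, ae_restrict_mem hO] with β hβ hβO
  have hγ : ∀ e, 0 < affineChart e₀ β e := affineChart_pos e₀ hβO
  have hψ := hpsi _ hγ
  have hP : 0 ≤ G.schwingerFactor d (affineChart e₀ β) :=
    mul_nonneg (Finset.prod_nonneg fun e _ => (Real.rpow_pos_of_pos (hγ e) _).le) (by positivity)
  rw [lintegral_rpow_mul_exp_neg_div hM (div_pos hβ.2 hψ), ← ENNReal.ofReal_mul hP,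
    G.schwingerFactor_mul_Gamma_div x hψ hβ.2, ENNReal.ofReal_mul (Real.Gamma_pos_of_pos hM).le]

theorem parametric_representation {d : ℕ} (hd : 2 < d) (hpos : ∀ e, 0 < G.weight e)
    {x : X → EuclideanSpace ℝ (Fin d)} (hconv : G.Converges d x) (e₀ : E) :
    ProjectiveIntegrable e₀ (G.parametricIntegrand x) ∧
      G.feynmanIntegral d x =
        Real.Gamma (G.superficialDegree d) / (∏ e, Real.Gamma (lam d * G.weight e)) *
          projectiveIntegral e₀ (G.parametricIntegrand x) := by
  obtain ⟨hM, hrep⟩ := G.projective_representation hd hpos hconv e₀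
  have hO := measurableSet_positiveOrthant {e : E // e ≠ e₀}
  have hmeas : Measurable fun β => G.parametricIntegrand x (affineChart e₀ β) :=
    (G.measurable_parametricIntegrand x).comp
      ((measurable_insertCoord e₀).comp measurable_prodMk_left)
  have hnonneg : 0 ≤ᵐ[volume.restrict (positiveOrthant {e : E // e ≠ e₀})]
      fun β => G.parametricIntegrand x (affineChart e₀ β) := by
    filter_upwards [ae_restrict_mem hO] with β hβ
    have hγ : ∀ e, 0 < affineChart e₀ β e := affineChart_pos e₀ hβ
    exact div_nonneg (Finset.prod_nonneg fun e _ => (Real.rpow_pos_of_pos (hγ e) _).le)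
      (mul_nonneg (Real.rpow_nonneg (G.phi_nonneg x hγ) _)
        (Real.rpow_nonneg (G.psi_nonneg hγ) _))
  have hΓM := Real.Gamma_pos_of_pos hM
  have hΓ : ∀ e, 0 < Real.Gamma (lam d * G.weight e) := fun e =>
    Real.Gamma_pos_of_pos (mul_pos (lam_pos hd) (hpos e))
  have hfin : (∏ e, ENNReal.ofReal (Real.Gamma (lam d * G.weight e))) *
      G.positionIntegral d x ≠ ∞ :=
    ENNReal.mul_ne_top (ENNReal.prod_ne_top fun e _ => ENNReal.ofReal_ne_top) hconv.ne
  -- As `Γ(M) > 0`, an infinite parametric integral would make the Feynman integral infinite.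
  have hfin' : ∫⁻ β in positiveOrthant {e : E // e ≠ e₀},
      ENNReal.ofReal (G.parametricIntegrand x (affineChart e₀ β)) ≠ ∞ := by
    intro h
    rw [hrep, h, ENNReal.mul_top (by simpa using hΓM)] at hfin
    exact hfin rfl
  refine ⟨(lintegral_ofReal_ne_top_iff_integrable hmeas.aestronglyMeasurable hnonneg).1 hfin', ?_⟩
  have hint : projectiveIntegral e₀ (G.parametricIntegrand x) =
      (∫⁻ β in positiveOrthant {e : E // e ≠ e₀},
        ENNReal.ofReal (G.parametricIntegrand x (affineChart e₀ β))).toReal :=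
    integral_eq_lintegral_of_nonneg_ae hnonneg hmeas.aestronglyMeasurable
  have h := congrArg ENNReal.toReal hrep
  rw [ENNReal.toReal_mul, ENNReal.toReal_mul, ENNReal.toReal_prod,
    ENNReal.toReal_ofReal hΓM.le, ← hint,
    Finset.prod_congr rfl fun e _ => ENNReal.toReal_ofReal (hΓ e).le] at h
  rw [feynmanIntegral, div_mul_eq_mul_div, eq_div_iff (Finset.prod_pos fun e _ => hΓ e).ne', ← h,
    mul_comm]

end Analysis

end FeynmanGraph

theorem corollary1p4 {X I E : Type*} [Fintype X] [DecidableEq X] [Fintype I]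
    [Fintype E] [DecidableEq E] [Nonempty E]
    (G : FeynmanGraph X I E) (hpos : ∀ e, 0 < G.weight e)
    (d : ℕ) (hd : 2 < d)
    (x : X → EuclideanSpace ℝ (Fin d)) (hx : Function.Injective x)
    (hconv : G.Converges d x) :
    0 < G.superficialDegree d ∧
    IsProjectiveDensity (G.parametricIntegrand x) ∧
    (∀ e₀ : E,
      ProjectiveIntegrable e₀ (G.parametricIntegrand x) ∧
      G.feynmanIntegral d x =
        Real.Gamma (G.superficialDegree d) / (∏ e, Real.Gamma (FeynmanGraph.lam d * G.weight e)) *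
          projectiveIntegral e₀ (G.parametricIntegrand x)) ∧
    (∀ (p : Set (Set (X ⊕ I))) (α : E → ℝ), (∀ e, α e ≠ 0) →
      G.forestPoly p α = (∏ e, α e) * G.dualForestPoly p (fun e => (α e)⁻¹)) := by
  -- The positivity of `M` is read off in an affine chart, which requires an edge.
  obtain ⟨e₀⟩ := ‹Nonempty E›
  exact ⟨(G.projective_representation hd hpos hconv e₀).1,
    G.isProjectiveDensity_parametricIntegrand x,
    fun e => G.parametric_representation hd hpos hconv e,
    G.forestPoly_eq_prod_mul_dualForestPoly⟩
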